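/- Theorem 3.2. Let $G=(V,E,\mu,m)$ be a locally finite weighted graph (self-loops allowed): $\mu_{xy}=\mu_{yx}\ge 0$ are edge weights, with $\mu_{xy}=0$ if $x\not\sim y$, and $m:V\to(0,\infty)$ is a measure on the vertices. For functions on $V$ put $$\Delta f(x)=\frac1{m(x)}\sum_{y}\mu_{xy}(f(y)-f(x)),\qquad \Gamma(f,g)=\tfrac12\big(\Delta(fg)-f\Delta g-g\Delta f\big),$$ $$\Gamma_2(f,g)=\tfrac12\big(\Delta\Gamma(f,g)-\Gamma(f,\Delta g)-\Gamma(g,\Delta f)\big),$$ and $\Gamma(f)=\Gamma(f,f)$, $\Gamma_2(f)=\Gamma_2(f,f)$. Let $Q(f)=\frac12\sum_{x,y}\mu_{xy}(f(y)-f(x))^2$, let $D(Q)\subset \ell^2(V,m)$ be the closure of the finitely supported functions in the norm $(\|f\|_{\ell^2(V,m)}^2+Q(f))^{1/2}$, and let $P_t=e^{t\Delta}$, $t\ge0$, be the heat semigroup on $\ell^2(V,m)$, that is, the strongly continuous semigroup generated by the (possibly unbounded) Laplacian $\Delta$ with domain $D(\Delta)=\{f\in D(Q):\Delta f\in \ell^2(V,m)\}$.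 Suppose that $G$ is complete, i.e. there is a nondecreasing sequence $(\eta_k)_{k\ge1}$ of finitely supported functions with $\eta_k\to1$ pointwise and $\Gamma(\eta_k)\le \frac1k$, and that $m$ is nondegenerate, i.e. $\inf_{x\in V}m(x)>0$. Then for every $f\in D(Q)$ the functions $f$, $f^2$ and $\Gamma(f)$ lie in $\ell^2(V,m)$, and for every $K\in\mathbb R$ the following are equivalent: (a) $G$ satisfies $CD(K,\infty)$: $\Gamma_2(f)(x)\ge K\,\Gamma(f)(x)$ for all $f:V\to\mathbb R$ and all $x\in V$. (b) For every finitely supported $f$, every $t\ge0$ and at every vertex, $$P_t(f^2)-(P_tf)^2\le \frac{1-e^{-2Kt}}{K}\,P_t(\Gamma(f)).$$ (c) The same inequality holds for every $f\in D(Q)$, every $t\ge0$ and at every vertex. For $K=0$ the factor $\frac{1-e^{-2Kt}}{K}$ is read as its limit $2t$. -/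

import Mathlib

open Filter Topology
open scoped ENNReal

universe u

/-- A locally finite weighted graph on the vertex set `V`: a symmetric adjacency relation
(self-loops are allowed), symmetric nonnegative edge weights `μ`, extended by zero to pairs which
are not adjacent, and a positive vertex measure `m`. -/
structure WeightedGraph (V : Type u) where
  Adj : V → V → Prop
  adj_symm : ∀ x y, Adj x y → Adj y x
  finite_nbrs : ∀ x, {y | Adj x y}.Finite
  μ : V → V → ℝ
  μ_symm : ∀ x y, μ x y = μ y x
  μ_nonneg : ∀ x y, 0 ≤ μ x y
  μ_eq_zero : ∀ x y, ¬ Adj x y → μ x y = 0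
  m : V → ℝ
  m_pos : ∀ x, 0 < m x

namespace WeightedGraph

variable {V : Type u} (G : WeightedGraph V)

/-- The (finite) set of neighbours of `x`. -/
noncomputable def nbrs (x : V) : Finset V := (G.finite_nbrs x).toFinset

/-- The formal Laplacian `Δ f (x) = (1 / m x) ∑ y, μ x y (f y - f x)`; the sum is over the finitely
many neighbours of `x`. -/
noncomputable def laplacian (f : V → ℝ) (x : V) : ℝ :=
  (1 / G.m x) * ∑ y ∈ G.nbrs x, G.μ x y * (f y - f x)

/-- The gradient form `Γ(f, g) = (Δ(fg) - f Δg - g Δf) / 2`. -/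
noncomputable def gamma (f g : V → ℝ) (x : V) : ℝ :=
  (1 / 2) * (G.laplacian (f * g) x - f x * G.laplacian g x - g x * G.laplacian f x)

/-- The iterated gradient form `Γ₂(f, g) = (Δ Γ(f, g) - Γ(f, Δg) - Γ(g, Δf)) / 2`. -/
noncomputable def gamma₂ (f g : V → ℝ) (x : V) : ℝ :=
  (1 / 2) * (G.laplacian (G.gamma f g) x - G.gamma f (G.laplacian g) x
    - G.gamma g (G.laplacian f) x)

/-- The curvature-dimension condition `CD(K, ∞)`. -/
def CD (K : ℝ) : Prop :=
  ∀ (f : V → ℝ) (x : V), K * G.gamma f f x ≤ G.gamma₂ f f x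

/-- The measure is nondegenerate: `inf m > 0`. -/
def Nondegenerate : Prop := ∃ δ > 0, ∀ x, δ ≤ G.m x

/-- Completeness: there are finitely supported `η₁ ≤ η₂ ≤ …` converging pointwise to `1` with
`Γ(η_k) ≤ 1 / k`. -/
def IsComplete : Prop :=
  ∃ η : ℕ → V → ℝ, (∀ k, (Function.support (η k)).Finite) ∧ Monotone η ∧
    (∀ x, Tendsto (fun k => η k x) atTop (𝓝 1)) ∧
    ∀ k : ℕ, 1 ≤ k → ∀ x, G.gamma (η k) (η k) x ≤ 1 / (k : ℝ)

/-- Membership in `ℓ²(V, m)`. -/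
def MemEll2 (f : V → ℝ) : Prop := Summable fun x => G.m x * f x ^ 2

/-- The energy `Q(f) = (1/2) ∑ x, ∑ y, μ x y (f y - f x)²`, with values in `[0, ∞]`. -/
noncomputable def energy (f : V → ℝ) : ℝ≥0∞ :=
  2⁻¹ * ∑' x, ∑' y, ENNReal.ofReal (G.μ x y * (f y - f x) ^ 2)

/-- The squared form norm `‖f‖² + Q(f)`, with values in `[0, ∞]`. -/
noncomputable def formNormSq (f : V → ℝ) : ℝ≥0∞ :=
  (∑' x, ENNReal.ofReal (G.m x * f x ^ 2)) + G.energy f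

/-- The form domain `D(Q)`: the closure of the finitely supported functions in the form norm
`(‖f‖² + Q(f))^(1/2)`. -/
def MemDQ (f : V → ℝ) : Prop :=
  ∃ u : ℕ → V → ℝ, (∀ n, (Function.support (u n)).Finite) ∧
    Tendsto (fun n => G.formNormSq (u n - f)) atTop (𝓝 0)

/-- The domain `D(Δ)` of the (possibly unbounded) self-adjoint Laplacian associated with `Q`;
on it the operator acts by the formal Laplacian. -/
def MemDLaplacian (f : V → ℝ) : Prop := G.MemDQ f ∧ G.MemEll2 (G.laplacian f)

theorem memEll2_mul {f g : V → ℝ} (hf : G.MemEll2 f) (hg : G.MemEll2 g) :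
    Summable fun x => G.m x * (f x * g x) := by
  refine Summable.of_norm_bounded (hf.add hg) fun x => ?_
  have := G.m_pos x
  rw [Real.norm_eq_abs, abs_mul, abs_of_pos this, ← mul_add, abs_mul]
  gcongr
  rw [← sq_abs (f x), ← sq_abs (g x)]
  nlinarith [sq_nonneg (|f x| - |g x|), abs_nonneg (f x), abs_nonneg (g x)]

/-- `ℓ²(V, m)` as a space of functions. -/
def ell2Submodule : Submodule ℝ (V → ℝ) where
  carrier := {f | G.MemEll2 f}
  zero_mem' := by simp [MemEll2, summable_zero]
  add_mem' := by
    intro f g hf hg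
    have := (Summable.add hf hg).add ((G.memEll2_mul hf hg).mul_left 2)
    refine this.congr fun x => ?_
    simp only [Pi.add_apply]
    ring
  smul_mem' := by
    intro c f hf
    refine (Summable.mul_left (c ^ 2) hf).congr fun x => ?_
    simp only [Pi.smul_apply, smul_eq_mul]
    ring

/-- The real Hilbert space `ℓ²(V, m)`. -/
def Ell2 : Type u := G.ell2Submodule

instance : AddCommGroup G.Ell2 := inferInstanceAs (AddCommGroup G.ell2Submodule)

noncomputable instance : Module ℝ G.Ell2 := inferInstanceAs (Module ℝ G.ell2Submodule)

instance : CoeFun G.Ell2 (fun _ => V → ℝ) := ⟨fun f => f.1⟩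

variable {G}

theorem Ell2.mem (f : G.Ell2) : G.MemEll2 f := f.2

theorem Ell2.ext {f g : G.Ell2} (h : ∀ x, f x = g x) : f = g := Subtype.ext (funext h)

theorem Ell2.add_apply (f g : G.Ell2) (x : V) : (f + g) x = f x + g x := rfl

theorem Ell2.sub_apply (f g : G.Ell2) (x : V) : (f - g) x = f x - g x := rfl

theorem Ell2.smul_apply (c : ℝ) (f : G.Ell2) (x : V) : (c • f) x = c * f x := rfl

variable (G)

/-- The inner product `⟨f, g⟩ = ∑ x, m x f x g x`. -/
noncomputable instance innerCore : InnerProductSpace.Core ℝ G.Ell2 where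
  inner f g := ∑' x, G.m x * (f x * g x)
  conj_inner_symm f g := by
    simp only [conj_trivial]
    exact tsum_congr fun x => by ring
  re_inner_nonneg f := by
    simp only [RCLike.re_to_real]
    exact tsum_nonneg fun x => mul_nonneg (G.m_pos x).le (mul_self_nonneg _)
  add_left f g h := by
    rw [← (G.memEll2_mul f.mem h.mem).tsum_add (G.memEll2_mul g.mem h.mem)]
    exact tsum_congr fun x => by rw [Ell2.add_apply]; ring
  smul_left f g c := by
    simp only [conj_trivial]
    rw [← tsum_mul_left]
    exact tsum_congr fun x => by rw [Ell2.smul_apply]; ring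
  definite f hf := by
    have hs := (hasSum_zero_iff_of_nonneg
      (fun x => mul_nonneg (G.m_pos x).le (mul_self_nonneg (f x)))).1
      (hf ▸ (G.memEll2_mul f.mem f.mem).hasSum)
    refine Ell2.ext fun x => ?_
    have := congrFun hs x
    change f x = 0
    simpa [(G.m_pos x).ne'] using this

noncomputable instance : NormedAddCommGroup G.Ell2 :=
  (innerCore G).toNormedAddCommGroup

noncomputable instance : InnerProductSpace ℝ G.Ell2 :=
  InnerProductSpace.ofCore (innerCore G).toCore

variable {G}

theorem Ell2.inner_def (f g : G.Ell2) : inner ℝ f g = ∑' x, G.m x * (f x * g x) := rfl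

theorem Ell2.norm_sq (f : G.Ell2) : ‖f‖ ^ 2 = ∑' x, G.m x * f x ^ 2 := by
  rw [← real_inner_self_eq_norm_sq, Ell2.inner_def]
  exact tsum_congr fun x => by ring

theorem norm_sq_lp {ι : Type*} (w : lp (fun _ : ι => ℝ) 2) : ‖w‖ ^ 2 = ∑' i, w i ^ 2 := by
  rw [← real_inner_self_eq_norm_sq, lp.inner_eq_tsum]
  exact tsum_congr fun i => by simp [sq]

theorem summable_sq_lp {ι : Type*} (w : lp (fun _ : ι => ℝ) 2) : Summable fun i => w i ^ 2 := by
  refine (lp.summable_inner w w).congr fun i => ?_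
  simp [sq]

theorem memℓp_two_iff {ι : Type*} {f : ι → ℝ} :
    Memℓp f 2 ↔ Summable fun i => f i ^ 2 := by
  rw [memℓp_gen_iff (by norm_num)]
  simp

theorem sqrt_mul_inv (x : V) (a : ℝ) : G.m x * (a / √(G.m x)) ^ 2 = a ^ 2 := by
  rw [div_pow, Real.sq_sqrt (G.m_pos x).le, mul_div_cancel₀ _ (G.m_pos x).ne']

/-- `f ↦ √m f` is a unitary map onto the unweighted `ℓ²`. -/
noncomputable def Ell2.equivLp : G.Ell2 ≃ₗᵢ[ℝ] lp (fun _ : V => ℝ) 2 where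
  toFun f := ⟨fun x => √(G.m x) * f x, memℓp_two_iff.2 (f.mem.congr fun x => by
    rw [mul_pow, Real.sq_sqrt (G.m_pos x).le])⟩
  invFun w := ⟨fun x => w x / √(G.m x), (summable_sq_lp w).congr fun x => (sqrt_mul_inv x _).symm⟩
  map_add' f g := lp.ext (funext fun x => mul_add _ _ _)
  map_smul' c f := lp.ext (funext fun x => mul_left_comm _ _ _)
  left_inv f := Ell2.ext fun x => mul_div_cancel_left₀ _ (Real.sqrt_pos.2 (G.m_pos x)).ne'
  right_inv w := lp.ext (funext fun x => mul_div_cancel₀ _ (Real.sqrt_pos.2 (G.m_pos x)).ne')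
  norm_map' f := by
    rw [← sq_eq_sq₀ (norm_nonneg _) (norm_nonneg _), norm_sq_lp, Ell2.norm_sq]
    refine tsum_congr fun x => ?_
    change (√(G.m x) * f x) ^ 2 = _
    rw [mul_pow, Real.sq_sqrt (G.m_pos x).le]

instance : CompleteSpace G.Ell2 :=
  (completeSpace_congr (e := (Ell2.equivLp (G := G)).toEquiv)
    (Ell2.equivLp (G := G)).isometry.isUniformEmbedding).2 inferInstance

variable (G)

/-- A strongly continuous semigroup of bounded operators on `ℓ²(V, m)` whose infinitesimal
generator is the Laplacian `Δ` with domain `D(Δ)`, that is, `P t = e^{tΔ}`. -/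
structure IsHeatSemigroup (P : ℝ → G.Ell2 →L[ℝ] G.Ell2) : Prop where
  zero : P 0 = 1
  add : ∀ s t, 0 ≤ s → 0 ≤ t → P (s + t) = P s * P t
  tendsto_zero : ∀ f, Tendsto (fun t => P t f) (𝓝[>] 0) (𝓝 f)
  generator : ∀ f h : G.Ell2, Tendsto (fun t : ℝ => t⁻¹ • (P t f - f)) (𝓝[>] 0) (𝓝 h) ↔
    G.MemDLaplacian f ∧ ∀ x, G.laplacian f x = h x

end WeightedGraph

/-! ### Hille–Yosida for the bounded resolvent of a nonnegative self-adjoint operator -/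

section semigroup
variable {H : Type*} [NormedAddCommGroup H] [InnerProductSpace ℝ H]

theorem tendsto_zero_of_denseRange {ι : Type*} {l : Filter ι} (R : H →L[ℝ] H)
    (hR : DenseRange R) (L : ι → H →L[ℝ] H) (C : ℝ) (hC : 0 ≤ C)
    (hL : ∀ᶠ i in l, ∀ u, ‖L i u‖ ≤ C * ‖u‖)
    (h0 : ∀ g, Tendsto (fun i => L i (R g)) l (𝓝 0)) (f : H) :
    Tendsto (fun i => L i f) l (𝓝 0) := by
  rw [Metric.tendsto_nhds]
  intro ε hε
  obtain ⟨g, hg⟩ := hR.exists_dist_lt f (ε := ε / (2 * (C + 1))) (by positivity)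
  filter_upwards [hL, (Metric.tendsto_nhds.1 (h0 g)) (ε / 2) (by positivity)] with i hi hi2
  rw [dist_zero_right] at hi2 ⊢
  have h1 : L i f = L i (f - R g) + L i (R g) := by simp
  rw [dist_eq_norm] at hg
  have h2 : C * ‖f - R g‖ ≤ C * (ε / (2 * (C + 1))) := by gcongr
  have h3 : C * (ε / (2 * (C + 1))) ≤ ε / 2 := by
    rw [mul_div_assoc', div_le_div_iff₀ (by positivity) (by positivity)]
    nlinarith
  calc ‖L i f‖ ≤ ‖L i (f - R g)‖ + ‖L i (R g)‖ := by rw [h1]; exact norm_add_le _ _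
    _ < ε / 2 + ε / 2 := by linarith [hi (f - R g)]
    _ = ε := by ring

/-- Partial sums of `1 - 1/r = - ∑ (1 - r)^(k+1)`, evaluated at the bounded operator `R`. -/
noncomputable def approxGen (R : H →L[ℝ] H) (n : ℕ) : H →L[ℝ] H :=
  - ∑ k ∈ Finset.range n, (1 - R) ^ (k + 1)

theorem approxGen_mul (R : H →L[ℝ] H) (n : ℕ) :
    approxGen R n * R = (R - 1) + (1 - R) ^ (n + 1) := by
  induction n with
  | zero => simp [approxGen]
  | succ n ih =>
    have : approxGen R (n + 1) = approxGen R n - (1 - R) ^ (n + 1) := by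
      simp [approxGen, Finset.sum_range_succ]; abel
    rw [this, sub_mul, ih, pow_succ _ (n + 1)]
    noncomm_ring

theorem commute_approxGen (R : H →L[ℝ] H) (n : ℕ) : Commute (approxGen R n) R := by
  apply Commute.neg_left
  apply Commute.sum_left
  intro k _
  exact ((Commute.one_left R).sub_left (Commute.refl R)).pow_left _

theorem commute_approxGen' (R : H →L[ℝ] H) (n k : ℕ) :
    Commute (approxGen R n) (approxGen R k) := by
  apply Commute.neg_right
  apply Commute.sum_right
  intro k _
  exact ((Commute.one_right _).sub_right (commute_approxGen R n)).pow_right _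

variable [CompleteSpace H]

/-- Exponentials of a bounded dissipative operator are contractions. -/
theorem norm_exp_smul_apply_le (A : H →L[ℝ] H) (hA : ∀ u, inner ℝ (A u) u ≤ 0) {t : ℝ}
    (ht : 0 ≤ t) (f : H) : ‖NormedSpace.exp (t • A) f‖ ≤ ‖f‖ := by
  have hd : ∀ s : ℝ, HasDerivAt (fun s : ℝ => NormedSpace.exp (s • A) f)
      (A (NormedSpace.exp (s • A) f)) s := fun s =>
    (ContinuousLinearMap.apply ℝ H f).hasFDerivAt.comp_hasDerivAt s
      (hasDerivAt_exp_smul_const' A s)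
  have hd2 : ∀ s : ℝ, HasDerivAt (fun s : ℝ => ‖NormedSpace.exp (s • A) f‖ ^ 2)
      (2 * inner ℝ (NormedSpace.exp (s • A) f) (A (NormedSpace.exp (s • A) f))) s := fun s =>
    (hd s).norm_sq
  have hanti : Antitone (fun s : ℝ => ‖NormedSpace.exp (s • A) f‖ ^ 2) := by
    apply antitone_of_deriv_nonpos (fun s => (hd2 s).differentiableAt)
    intro s
    rw [(hd2 s).deriv, real_inner_comm]
    linarith [hA (NormedSpace.exp (s • A) f)]
  have := hanti ht
  simp only [zero_smul, NormedSpace.exp_zero, one_apply_eq_self] at this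
  exact (sq_le_sq₀ (norm_nonneg _) (norm_nonneg _)).1 this

theorem norm_exp_sub_exp_le (A B : H →L[ℝ] H) (hA : ∀ u, inner ℝ (A u) u ≤ 0)
    (hB : ∀ u, inner ℝ (B u) u ≤ 0) (hAB : Commute A B) {t : ℝ} (ht : 0 ≤ t) (f : H) :
    ‖NormedSpace.exp (t • A) f - NormedSpace.exp (t • B) f‖ ≤ t * ‖A f - B f‖ := by
  -- the derivative of `exp (s A) exp ((t - s) B) f`
  have hd : ∀ s : ℝ, HasDerivAt
      (fun s : ℝ => (NormedSpace.exp (s • A) * NormedSpace.exp ((t - s) • B)) f)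
      ((NormedSpace.exp (s • A) * NormedSpace.exp ((t - s) • B)) (A f - B f)) s := by
    intro s
    have h1 := hasDerivAt_exp_smul_const (𝕂 := ℝ) A s
    have h2 : HasDerivAt (fun s : ℝ => NormedSpace.exp ((t - s) • B))
        (- (NormedSpace.exp ((t - s) • B) * B)) s := by
      have := (hasDerivAt_exp_smul_const (𝕂 := ℝ) B (t - s)).scomp s
        ((hasDerivAt_id s).const_sub t)
      simpa [Function.comp_def] using this
    have h3 := (ContinuousLinearMap.apply ℝ H f).hasFDerivAt.comp_hasDerivAt s (h1.mul h2)
    refine h3.congr_deriv ?_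
    have hc : Commute A (NormedSpace.exp ((t - s) • B)) := (hAB.smul_right _).exp_right
    have : NormedSpace.exp (s • A) * A * NormedSpace.exp ((t - s) • B) =
        NormedSpace.exp (s • A) * NormedSpace.exp ((t - s) • B) * A := by
      rw [mul_assoc, hc.eq, mul_assoc]
    rw [this]
    simp [sub_eq_add_neg]
  have hb : ∀ s ∈ Set.Ico (0 : ℝ) t,
      ‖(NormedSpace.exp (s • A) * NormedSpace.exp ((t - s) • B)) (A f - B f)‖ ≤ ‖A f - B f‖ := by
    intro s hs
    exact (norm_exp_smul_apply_le A hA hs.1 _).trans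
      (norm_exp_smul_apply_le B hB (by linarith [hs.2]) _)
  have := norm_image_sub_le_of_norm_deriv_le_segment'
    (f := fun s : ℝ => (NormedSpace.exp (s • A) * NormedSpace.exp ((t - s) • B)) f)
    (fun s _ => (hd s).hasDerivWithinAt) hb t ⟨ht, le_rfl⟩
  simpa [mul_comm] using this

theorem norm_exp_sub_self_sub_le (A : H →L[ℝ] H) (hA : ∀ u, inner ℝ (A u) u ≤ 0) {t : ℝ}
    (ht : 0 ≤ t) (f : H) :
    ‖NormedSpace.exp (t • A) f - f - t • A f‖ ≤ t * (t * ‖A (A f)‖) := by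
  have hd : ∀ s : ℝ, HasDerivAt (fun s : ℝ => NormedSpace.exp (s • A) f - s • A f)
      (NormedSpace.exp (s • A) (A f) - A f) s := fun s => by
    have h1 := (ContinuousLinearMap.apply ℝ H f).hasFDerivAt.comp_hasDerivAt s
      (hasDerivAt_exp_smul_const (𝕂 := ℝ) A s)
    have h2 := h1.sub ((hasDerivAt_id s).smul_const (A f))
    refine h2.congr_deriv ?_
    simp
  have hb : ∀ s ∈ Set.Ico (0 : ℝ) t, ‖NormedSpace.exp (s • A) (A f) - A f‖ ≤ t * ‖A (A f)‖ := by
    intro s hs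
    have := norm_exp_sub_exp_le A 0 hA (by simp) (Commute.zero_right _) hs.1 (A f)
    simp only [smul_zero, NormedSpace.exp_zero, one_apply_eq_self,
      zero_apply, sub_zero] at this
    exact this.trans (by gcongr; exact hs.2.le)
  have := norm_image_sub_le_of_norm_deriv_le_segment'
    (f := fun s : ℝ => NormedSpace.exp (s • A) f - s • A f)
    (fun s _ => (hd s).hasDerivWithinAt) hb t ⟨ht, le_rfl⟩
  simp only [zero_smul, NormedSpace.exp_zero, one_apply_eq_self, sub_zero] at this
  rw [sub_right_comm, mul_comm]
  exact this


/-- A symmetric operator `R` with `R² ≤ R` and dense range is the resolvent at `1` of the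
generator of a strongly continuous contraction semigroup. -/
theorem exists_semigroup_of_resolvent (R : H →L[ℝ] H)
    (hsym : ∀ u v, inner ℝ (R u) v = inner ℝ u (R v))
    (hpos : ∀ u, ‖R u‖ ^ 2 ≤ inner ℝ (R u) u) (hR : DenseRange R) :
    ∃ T : ℝ → H →L[ℝ] H, T 0 = 1 ∧ (∀ s t, 0 ≤ s → 0 ≤ t → T (s + t) = T s * T t) ∧
      (∀ f, Tendsto (fun t => T t f) (𝓝[>] 0) (𝓝 f)) ∧
      ∀ f h, Tendsto (fun t : ℝ => t⁻¹ • (T t f - f)) (𝓝[>] 0) (𝓝 h) ↔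
        ∃ g, R g = f ∧ R g - g = h := by
  set X : H →L[ℝ] H := 1 - R with hX
  have Xapp : ∀ u, X u = u - R u := fun u => by simp [hX]
  have Xsym : ∀ u v, inner ℝ (X u) v = inner ℝ u (X v) := fun u v => by
    rw [Xapp, Xapp, inner_sub_left, inner_sub_right, hsym]
  have Rle : ∀ u, ‖R u‖ ≤ ‖u‖ := fun u => by
    have h1 := hpos u
    have h2 := real_inner_le_norm (R u) u
    by_contra! h
    nlinarith [norm_nonneg u, norm_nonneg (R u)]
  have Xsq : ∀ u, ‖X u‖ ^ 2 ≤ ‖u‖ ^ 2 - ‖R u‖ ^ 2 := fun u => by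
    rw [Xapp, norm_sub_sq_real, real_inner_comm]
    linarith [hpos u]
  have Xle : ∀ u, ‖X u‖ ≤ ‖u‖ := fun u => by
    rw [← sq_le_sq₀ (norm_nonneg _) (norm_nonneg _)]
    linarith [Xsq u, sq_nonneg ‖R u‖]
  have Xpos : ∀ u, 0 ≤ inner ℝ (X u) u := fun u => by
    rw [Xapp, inner_sub_left, real_inner_self_eq_norm_sq]
    nlinarith [real_inner_le_norm (R u) u, Rle u, norm_nonneg u]
  have Xpow_pos : ∀ (n : ℕ) u, 0 ≤ inner ℝ ((X ^ n) u) u := by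
    intro n
    induction n using Nat.twoStepInduction with
    | zero => intro u; simp only [pow_zero, one_apply_eq_self]; exact real_inner_self_nonneg
    | one => intro u; simpa using Xpos u
    | more n ih _ =>
      intro u
      have : (X ^ (n + 2)) u = X ((X ^ n) (X u)) := by
        rw [pow_succ, pow_succ']; rfl
      rw [this, Xsym]
      exact ih _
  have Xpow_le : ∀ (n : ℕ) u, ‖(X ^ n) u‖ ≤ ‖u‖ := by
    intro n
    induction n with
    | zero => intro u; simp
    | succ n ih => intro u; rw [pow_succ']; exact (Xle _).trans (ih u)
  have commXR : ∀ n : ℕ, Commute (X ^ n) R := fun n =>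
    ((Commute.one_left R).sub_left (Commute.refl R)).pow_left _
  have Xpow_tendsto : ∀ u, Tendsto (fun n : ℕ => (X ^ n) u) atTop (𝓝 0) := by
    intro u
    refine tendsto_zero_of_denseRange R hR (fun n => X ^ n) 1 zero_le_one
      (Eventually.of_forall fun n u => by rw [one_mul]; exact Xpow_le n u) ?_ u
    intro g
    have hstep : ∀ n : ℕ, ‖(X ^ (n + 1)) g‖ ^ 2 ≤ ‖(X ^ n) g‖ ^ 2 - ‖R ((X ^ n) g)‖ ^ 2 := by
      intro n
      have : (X ^ (n + 1)) g = X ((X ^ n) g) := by rw [pow_succ' X n]; rfl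
      rw [this]; exact Xsq _
    have hanti : Antitone (fun n : ℕ => ‖(X ^ n) g‖ ^ 2) :=
      antitone_nat_of_succ_le fun n => by linarith [hstep n, sq_nonneg ‖R ((X ^ n) g)‖]
    have hlim := tendsto_atTop_ciInf hanti ⟨0, by rintro _ ⟨n, rfl⟩; positivity⟩
    have hdiff := hlim.sub ((tendsto_add_atTop_iff_nat 1).2 hlim)
    rw [sub_self] at hdiff
    have hsq : Tendsto (fun n : ℕ => ‖R ((X ^ n) g)‖ ^ 2) atTop (𝓝 0) :=
      squeeze_zero (fun n => by positivity) (fun n => by linarith [hstep n]) hdiff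
    have h2 : Tendsto (fun n : ℕ => ‖R ((X ^ n) g)‖) atTop (𝓝 0) := by
      have := hsq.sqrt
      simpa [Real.sqrt_sq] using this
    rw [tendsto_zero_iff_norm_tendsto_zero]
    refine h2.congr fun n => ?_
    have := congrArg (fun L : H →L[ℝ] H => L g) (commXR n).eq
    simp only [mul_apply_eq_comp] at this
    rw [this]
  -- the approximating semigroups
  set A := approxGen R with hAdef
  have Adiss : ∀ (n : ℕ) u, inner ℝ (A n u) u ≤ 0 := by
    intro n u
    have : A n u = - ∑ k ∈ Finset.range n, (X ^ (k + 1)) u := by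
      simp [hAdef, approxGen, hX]
    rw [this, inner_neg_left, sum_inner, neg_nonpos]
    exact Finset.sum_nonneg fun k _ => Xpow_pos _ _
  have AR : ∀ (n : ℕ) g, A n (R g) = (R g - g) + (X ^ (n + 1)) g := by
    intro n g
    have := congrArg (fun L : H →L[ℝ] H => L g) (approxGen_mul R n)
    exact this
  have AR_tendsto : ∀ g, Tendsto (fun n => A n (R g)) atTop (𝓝 (R g - g)) := by
    intro g
    have := ((tendsto_add_atTop_iff_nat 1).2 (Xpow_tendsto g)).const_add (R g - g)
    rw [add_zero] at this
    exact this.congr fun n => (AR n g).symm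
  have Acomm : ∀ n g, A n (R g) = R (A n g) := by
    intro n g
    have := congrArg (fun L : H →L[ℝ] H => L g) (commute_approxGen R n).eq
    simpa using this
  set E : ℕ → ℝ → H →L[ℝ] H := fun n t => NormedSpace.exp (t • A n) with hE
  have Ele : ∀ n {t : ℝ}, 0 ≤ t → ∀ f, ‖E n t f‖ ≤ ‖f‖ := fun n t ht f =>
    norm_exp_smul_apply_le (A n) (Adiss n) ht f
  have Ecomm : ∀ n t g, E n t (R g) = R (E n t g) := by
    intro n t g
    have h : Commute (E n t) R := ((commute_approxGen R n).smul_left t).exp_left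
    have := congrArg (fun L : H →L[ℝ] H => L g) h.eq
    simpa using this
  have Ecauchy : ∀ {t : ℝ}, 0 ≤ t → ∀ f, CauchySeq (fun n => E n t f) := by
    intro t ht f
    rw [cauchySeq_iff_tendsto_dist_atTop_0]
    have key : Tendsto (fun p : ℕ × ℕ => (E p.1 t - E p.2 t) f) atTop (𝓝 0) := by
      refine tendsto_zero_of_denseRange R hR (fun p : ℕ × ℕ => E p.1 t - E p.2 t) 2 (by norm_num)
        (Eventually.of_forall fun p u => ?_) ?_ f
      · have := norm_sub_le (E p.1 t u) (E p.2 t u)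
        rw [sub_apply]
        linarith [Ele p.1 ht u, Ele p.2 ht u]
      · intro g
        have hc := cauchySeq_iff_tendsto_dist_atTop_0.1 (AR_tendsto g).cauchySeq
        have hc2 := hc.const_mul t
        rw [mul_zero] at hc2
        refine squeeze_zero_norm (fun p => ?_) hc2
        rw [dist_eq_norm, sub_apply]
        exact norm_exp_sub_exp_le _ _ (Adiss _) (Adiss _) (commute_approxGen' R _ _) ht _
    refine (tendsto_zero_iff_norm_tendsto_zero.1 key).congr fun p => ?_
    rw [dist_eq_norm, sub_apply]
  have hT : ∀ t : ℝ, ∃ L : H →L[ℝ] H, 0 ≤ t →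
      (∀ f, Tendsto (fun n => E n t f) atTop (𝓝 (L f))) ∧ ∀ f, ‖L f‖ ≤ ‖f‖ := by
    intro t
    by_cases ht : 0 ≤ t
    swap
    · exact ⟨0, fun h => absurd h ht⟩
    choose L hL using fun f => cauchySeq_tendsto_of_complete (Ecauchy ht f)
    have hLle : ∀ f, ‖L f‖ ≤ ‖f‖ := fun f =>
      le_of_tendsto (hL f).norm (Eventually.of_forall fun n => Ele n ht f)
    let L' : H →ₗ[ℝ] H :=
      { toFun := L
        map_add' := fun f g => tendsto_nhds_unique (hL (f + g))
          (((hL f).add (hL g)).congr fun n => (map_add (E n t) f g).symm)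
        map_smul' := fun c f => tendsto_nhds_unique (hL (c • f))
          (((hL f).const_smul c).congr fun n => (map_smul (E n t) c f).symm) }
    exact ⟨L'.mkContinuous 1 fun f => by rw [one_mul]; exact hLle f, fun _ => ⟨hL, hLle⟩⟩
  choose T hT using hT
  have Tlim : ∀ {t : ℝ}, 0 ≤ t → ∀ f, Tendsto (fun n => E n t f) atTop (𝓝 (T t f)) :=
    fun ht => (hT _ ht).1
  have Tle : ∀ {t : ℝ}, 0 ≤ t → ∀ f, ‖T t f‖ ≤ ‖f‖ := fun ht => (hT _ ht).2
  have Tcomm : ∀ {t : ℝ}, 0 ≤ t → ∀ g, T t (R g) = R (T t g) := by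
    intro t ht g
    exact tendsto_nhds_unique (Tlim ht (R g))
      (((R.continuous.tendsto _).comp (Tlim ht g)).congr fun n => (Ecomm n t g).symm)
  have T1 : ∀ {t : ℝ}, 0 ≤ t → ∀ g, ‖T t (R g) - R g‖ ≤ t * ‖R g - g‖ := by
    intro t ht g
    refine le_of_tendsto_of_tendsto ((Tlim ht (R g)).sub_const _).norm
      ((AR_tendsto g).norm.const_mul t) (Eventually.of_forall fun n => ?_)
    have := norm_exp_sub_exp_le (A n) 0 (Adiss n) (by simp) (Commute.zero_right _) ht (R g)
    simpa using this
  have T2 : ∀ {t : ℝ}, 0 ≤ t → ∀ g, ‖T t (R (R g)) - R (R g) - t • (R (R g) - R g)‖ ≤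
      t * (t * ‖R (R g - g) - (R g - g)‖) := by
    intro t ht g
    have h1 : Tendsto (fun n => A n (A n (R (R g)))) atTop (𝓝 (R (R g - g) - (R g - g))) := by
      have h : ∀ n, A n (A n (R (R g))) =
          ((R (R g - g) - (R g - g)) + (X ^ (n + 1)) (R g - g)) +
          (X ^ (n + 1)) (R g - g + (X ^ (n + 1)) g) := by
        intro n
        have e1 : A n (R (R g)) = R (R g - g) + (X ^ (n + 1)) (R g) := by
          rw [AR]; simp
        have e2 : (X ^ (n + 1)) (R g) = R ((X ^ (n + 1)) g) := by
          have := congrArg (fun L : H →L[ℝ] H => L g) (commXR (n + 1)).eq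
          simpa using this
        have e3 : A n (R ((X ^ (n + 1)) g)) = (X ^ (n + 1)) (R g - g + (X ^ (n + 1)) g) := by
          rw [AR, map_add, map_sub, e2]
        rw [e1, map_add, AR, e2, e3]
      have l1 := (tendsto_add_atTop_iff_nat 1).2 (Xpow_tendsto (R g - g))
      have l2 := (tendsto_add_atTop_iff_nat 1).2 (Xpow_tendsto g)
      have l3 : Tendsto (fun n => (X ^ (n + 1)) (R g - g + (X ^ (n + 1)) g)) atTop (𝓝 0) := by
        have : Tendsto (fun n => (X ^ (n + 1)) ((X ^ (n + 1)) g)) atTop (𝓝 0) :=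
          squeeze_zero_norm (fun n => Xpow_le _ _) (tendsto_zero_iff_norm_tendsto_zero.1 l2)
        have := l1.add this
        rw [add_zero] at this
        exact this.congr fun n => (map_add _ _ _).symm
      have := (l1.const_add (R (R g - g) - (R g - g))).add l3
      rw [add_zero, add_zero] at this
      exact this.congr fun n => (h n).symm
    refine le_of_tendsto_of_tendsto
      (((Tlim ht (R (R g))).sub_const (R (R g))).sub ((AR_tendsto (R g)).const_smul t)).norm
      ((h1.norm.const_mul t).const_mul t) (Eventually.of_forall fun n => ?_)
    exact norm_exp_sub_self_sub_le (A n) (Adiss n) ht _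
  have pos_mem : ∀ᶠ t : ℝ in 𝓝[>] 0, 0 < t := eventually_mem_nhdsWithin
  have lim_id : Tendsto (fun t : ℝ => t) (𝓝[>] 0) (𝓝 0) := tendsto_nhdsWithin_of_tendsto_nhds tendsto_id
  have gen : ∀ g, Tendsto (fun t : ℝ => t⁻¹ • (T t (R g) - R g)) (𝓝[>] 0) (𝓝 (R g - g)) := by
    intro g
    have key : Tendsto (fun t : ℝ => (t⁻¹ • (T t * R - R) - (R - 1)) g) (𝓝[>] 0) (𝓝 0) := by
      refine tendsto_zero_of_denseRange R hR (fun t : ℝ => t⁻¹ • (T t * R - R) - (R - 1)) 4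
        (by norm_num) ?_ ?_ g
      · filter_upwards [pos_mem] with t ht u
        have e : (t⁻¹ • (T t * R - R) - (R - 1)) u = t⁻¹ • (T t (R u) - R u) - (R u - u) := by simp
        have b1 : ‖R u - u‖ ≤ 2 * ‖u‖ := (norm_sub_le _ _).trans (by linarith [Rle u])
        have b2 : ‖t⁻¹ • (T t (R u) - R u)‖ ≤ ‖R u - u‖ := by
          rw [norm_smul, Real.norm_eq_abs, abs_of_pos (inv_pos.2 ht), inv_mul_le_iff₀ ht]
          exact T1 ht.le u
        rw [e]
        exact (norm_sub_le _ _).trans (by linarith)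
      · intro k
        have l := lim_id.mul_const (‖R (R k - k) - (R k - k)‖)
        rw [zero_mul] at l
        refine squeeze_zero_norm' ?_ l
        filter_upwards [pos_mem] with t ht
        have e : (t⁻¹ • (T t * R - R) - (R - 1)) (R k) =
            t⁻¹ • (T t (R (R k)) - R (R k) - t • (R (R k) - R k)) := by
          rw [smul_sub t⁻¹ _ (t • _), smul_smul, inv_mul_cancel₀ ht.ne', one_smul]; simp
        rw [e, norm_smul, Real.norm_eq_abs, abs_of_pos (inv_pos.2 ht), inv_mul_le_iff₀ ht]
        exact T2 ht.le k
    have := key.add_const (R g - g)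
    rw [zero_add] at this
    refine this.congr fun t => ?_
    simp
  refine ⟨T, ?_, ?_, ?_, ?_⟩
  · ext f
    refine tendsto_nhds_unique (Tlim le_rfl f) ?_
    simp [hE, NormedSpace.exp_zero]
  · intro s t hs ht
    ext f
    refine tendsto_nhds_unique (Tlim (add_nonneg hs ht) f) ?_
    have hmul : ∀ n, E n (s + t) f = E n s (E n t f) := by
      intro n
      have : E n (s + t) = E n s * E n t := by
        simp only [hE]
        let _ : NormedAlgebra ℚ (H →L[ℝ] H) := NormedAlgebra.restrictScalars ℚ ℝ (H →L[ℝ] H)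
        rw [add_smul, NormedSpace.exp_add_of_commute]
        exact ((Commute.refl (A n)).smul_left s).smul_right t
      rw [this]; rfl
    have h1 : Tendsto (fun n => E n s (E n t f - T t f)) atTop (𝓝 0) := by
      have := ((Tlim ht f).sub_const (T t f))
      rw [sub_self] at this
      exact squeeze_zero_norm (fun n => Ele n hs _) (tendsto_zero_iff_norm_tendsto_zero.1 this)
    have h2 := h1.add (Tlim hs (T t f))
    rw [zero_add] at h2
    refine h2.congr fun n => ?_
    rw [hmul, map_sub]; abel
  · intro f
    have key : Tendsto (fun t : ℝ => (T t - 1) f) (𝓝[>] 0) (𝓝 0) := by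
      refine tendsto_zero_of_denseRange R hR (fun t : ℝ => T t - 1) 2 (by norm_num) ?_ ?_ f
      · filter_upwards [pos_mem] with t ht u
        have := norm_sub_le (T t u) u
        rw [sub_apply, one_apply_eq_self]
        linarith [Tle ht.le u]
      · intro g
        have l := lim_id.mul_const (‖R g - g‖)
        rw [zero_mul] at l
        refine squeeze_zero_norm' ?_ l
        filter_upwards [pos_mem] with t ht
        exact T1 ht.le g
    have := key.add_const f
    rw [zero_add] at this
    refine this.congr fun t => ?_
    simp
  · intro f h
    constructor
    · intro hf
      refine ⟨f - h, ?_⟩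
      have hu := hf.sub (gen (f - h))
      -- `u = f - R (f - h)` is an eigenvector of the generator with eigenvalue one
      set u := f - R (f - h) with hudef
      have e : h - (R (f - h) - (f - h)) = u := by rw [hudef]; abel
      rw [e] at hu
      have hin : Tendsto (fun t : ℝ => inner ℝ (t⁻¹ • (T t u - u)) u) (𝓝[>] 0)
          (𝓝 (inner ℝ u u)) := by
        refine (Tendsto.inner hu tendsto_const_nhds).congr fun t => ?_
        rw [← smul_sub, hudef, map_sub (T t) f]
        congr 2
        abel
      have hle : inner ℝ u u ≤ 0 := by
        refine le_of_tendsto hin ?_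
        filter_upwards [pos_mem] with t ht
        rw [real_inner_smul_left]
        apply mul_nonpos_of_nonneg_of_nonpos (inv_pos.2 ht).le
        rw [inner_sub_left, real_inner_self_eq_norm_sq]
        nlinarith [real_inner_le_norm (T t u) u, Tle ht.le u, norm_nonneg u]
      have hu0 : u = 0 := inner_self_eq_zero.1 (le_antisymm hle real_inner_self_nonneg)
      have hf2 : R (f - h) = f := by rw [hudef, sub_eq_zero] at hu0; exact hu0.symm
      exact ⟨hf2, by rw [hf2]; abel⟩
    · rintro ⟨g, rfl, rfl⟩
      exact gen g

end semigroup

namespace WeightedGraph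

variable {V : Type u} (G : WeightedGraph V)

/-! ### Existence of the heat semigroup -/

section existence

/-- The map `f ↦ (√m f, √(μ/2) df)`, whose squared `ℓ²`-norm is `‖f‖² + Q(f)`. -/
noncomputable def embed (f : V → ℝ) : V ⊕ V × V → ℝ :=
  Sum.elim (fun x => √(G.m x) * f x) (fun p => √(G.μ p.1 p.2 / 2) * (f p.2 - f p.1))

theorem embed_add (f g : V → ℝ) : G.embed (f + g) = G.embed f + G.embed g := by
  funext i; rcases i with x | p <;> simp [embed] <;> ring

theorem embed_sub (f g : V → ℝ) : G.embed (f - g) = G.embed f - G.embed g := by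
  funext i; rcases i with x | p <;> simp [embed] <;> ring

theorem embed_smul (c : ℝ) (f : V → ℝ) : G.embed (c • f) = c • G.embed f := by
  funext i; rcases i with x | p <;> simp [embed] <;> ring

theorem formNormSq_eq (f : V → ℝ) :
    G.formNormSq f = ∑' i, ENNReal.ofReal (G.embed f i ^ 2) := by
  rw [Summable.tsum_sum ENNReal.summable ENNReal.summable, ENNReal.tsum_prod', formNormSq, energy,
    ← ENNReal.tsum_mul_left]
  congr 1
  · refine tsum_congr fun x => ?_
    simp only [embed, Sum.elim_inl, mul_pow, Real.sq_sqrt (G.m_pos x).le]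
  · refine tsum_congr fun x => ?_
    rw [← ENNReal.tsum_mul_left]
    refine tsum_congr fun y => ?_
    have h := G.μ_nonneg x y
    simp only [embed, Sum.elim_inr, mul_pow, Real.sq_sqrt (div_nonneg h zero_le_two)]
    rw [show (2⁻¹ : ℝ≥0∞) = ENNReal.ofReal (2⁻¹) by
      rw [ENNReal.ofReal_inv_of_pos two_pos]; simp, ← ENNReal.ofReal_mul (by norm_num)]
    congr 1
    ring

theorem mem_nbrs {x y : V} : y ∈ G.nbrs x ↔ G.Adj x y := by simp [nbrs]

theorem embed_memℓp {f : V → ℝ} (hf : (Function.support f).Finite) : Memℓp (G.embed f) 2 := by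
  rw [memℓp_two_iff]
  refine summable_of_hasFiniteSupport ?_
  let S : Set (V ⊕ V × V) := (Sum.inl '' Function.support f) ∪
    (⋃ x ∈ Function.support f, (fun y => Sum.inr (x, y)) '' {y | G.Adj x y}) ∪
    (⋃ x ∈ Function.support f, (fun y => Sum.inr (y, x)) '' {y | G.Adj x y})
  have hS : S.Finite :=
    ((hf.image _).union (hf.biUnion fun x _ => (G.finite_nbrs x).image _)).union
      (hf.biUnion fun x _ => (G.finite_nbrs x).image _)
  refine hS.subset ?_
  rintro (x | ⟨x, y⟩) h
  · left; left
    refine ⟨x, ?_, rfl⟩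
    intro h0
    apply h
    simp [embed, h0]
  · have hadj : G.Adj x y := by
      by_contra hn
      apply h
      simp [embed, G.μ_eq_zero x y hn]
    by_cases hx : f x = 0
    · have hy : f y ≠ 0 := by
        intro hy
        apply h
        simp [embed, hx, hy]
      right
      simp only [Set.mem_iUnion]
      exact ⟨y, hy, x, G.adj_symm _ _ hadj, rfl⟩
    · left; right
      simp only [Set.mem_iUnion]
      exact ⟨x, hx, y, hadj, rfl⟩

/-- The image of the finitely supported functions under `embed`. -/
noncomputable def core : Submodule ℝ (lp (fun _ : V ⊕ V × V => ℝ) 2) where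
  carrier := {w | ∃ f : V → ℝ, (Function.support f).Finite ∧ (w : V ⊕ V × V → ℝ) = G.embed f}
  zero_mem' := ⟨0, by simp, by funext i; rcases i with x | p <;> simp [embed]⟩
  add_mem' := by
    rintro v w ⟨f, hf, hv⟩ ⟨g, hg, hw⟩
    exact ⟨f + g, (hf.union hg).subset (Function.support_add f g), by
      rw [lp.coeFn_add, hv, hw, embed_add]⟩
  smul_mem' := by
    rintro c v ⟨f, hf, hv⟩
    exact ⟨c • f, hf.subset (Function.support_const_smul_subset c f), by
      rw [lp.coeFn_smul, hv, embed_smul]⟩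

/-- The first component of the Hilbert space of pairs. -/
noncomputable def proj : lp (fun _ : V ⊕ V × V => ℝ) 2 →L[ℝ] G.Ell2 :=
  LinearMap.mkContinuous
    { toFun := fun w => ⟨fun x => w (Sum.inl x) / √(G.m x),
        ((summable_sq_lp w).comp_injective Sum.inl_injective).congr fun x =>
          (sqrt_mul_inv x _).symm⟩
      map_add' := fun v w => Ell2.ext fun x => add_div _ _ _
      map_smul' := fun c w => Ell2.ext fun x => mul_div_assoc _ _ _ } 1 <| by
    intro w
    rw [one_mul, ← sq_le_sq₀ (norm_nonneg _) (norm_nonneg _), Ell2.norm_sq, norm_sq_lp]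
    have h1 : ∀ x, G.m x * (w (Sum.inl x) / √(G.m x)) ^ 2 = w (Sum.inl x) ^ 2 :=
      fun x => sqrt_mul_inv x _
    refine le_of_eq_of_le (tsum_congr h1) ?_
    exact tsum_comp_le_tsum_of_inj (summable_sq_lp w) (fun _ => sq_nonneg _) Sum.inl_injective

theorem proj_apply (w : lp (fun _ : V ⊕ V × V => ℝ) 2) (x : V) :
    G.proj w x = w (Sum.inl x) / √(G.m x) := rfl

/-- The form domain, realised as a closed subspace of an `ℓ²` space. -/
noncomputable def formSpace : Submodule ℝ (lp (fun _ : V ⊕ V × V => ℝ) 2) :=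
  G.core.topologicalClosure

instance : CompleteSpace G.formSpace :=
  (G.core.isClosed_topologicalClosure).completeSpace_coe

theorem ofReal_norm_sq_lp {ι : Type*} (w : lp (fun _ : ι => ℝ) 2) :
    ENNReal.ofReal (‖w‖ ^ 2) = ∑' i, ENNReal.ofReal (w i ^ 2) := by
  rw [norm_sq_lp, ENNReal.ofReal_tsum_of_nonneg (fun _ => sq_nonneg _) (summable_sq_lp w)]

theorem embed_proj {w : lp (fun _ : V ⊕ V × V => ℝ) 2} (hw : w ∈ G.formSpace) :
    (w : V ⊕ V × V → ℝ) = G.embed (G.proj w) := by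
  have hcont : ∀ i, Continuous fun w : lp (fun _ : V ⊕ V × V => ℝ) 2 => w i := fun i =>
    (continuous_apply i).comp (lp.uniformContinuous_coe.continuous)
  have hs : ∀ x, √(G.m x) ≠ 0 := fun x => (Real.sqrt_pos.2 (G.m_pos x)).ne'
  have hclosed : IsClosed {w : lp (fun _ : V ⊕ V × V => ℝ) 2 |
      ∀ i, w i = G.embed (G.proj w) i} := by
    simp only [Set.ofPred_forall]
    refine isClosed_iInter fun i => isClosed_eq (hcont i) ?_
    rcases i with x | p
    · simp only [embed, Sum.elim_inl, proj_apply]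
      exact continuous_const.mul ((hcont _).div_const _)
    · simp only [embed, Sum.elim_inr, proj_apply]
      exact continuous_const.mul (((hcont _).div_const _).sub ((hcont _).div_const _))
  have hsub : (G.core : Set _) ⊆ {w : lp (fun _ : V ⊕ V × V => ℝ) 2 |
      ∀ i, w i = G.embed (G.proj w) i} := by
    rintro v ⟨f, -, hv⟩ i
    have : (G.proj v : V → ℝ) = f := by
      funext x
      rw [proj_apply, hv]
      simp [embed, hs x]
    rw [this, hv]
  exact funext (closure_minimal hsub hclosed hw)

theorem memDQ_of_mem {w : lp (fun _ : V ⊕ V × V => ℝ) 2} (hw : w ∈ G.formSpace) :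
    G.MemDQ (G.proj w) := by
  obtain ⟨v, hv, hlim⟩ := mem_closure_iff_seq_limit.1 hw
  choose u hu hvu using hv
  refine ⟨u, hu, ?_⟩
  have h1 : Tendsto (fun n => ENNReal.ofReal (‖v n - w‖ ^ 2)) atTop (𝓝 0) := by
    have := (tendsto_iff_norm_sub_tendsto_zero.1 hlim).pow 2
    simpa using ENNReal.tendsto_ofReal this
  refine h1.congr fun n => ?_
  rw [ofReal_norm_sq_lp, formNormSq_eq, embed_sub, ← G.embed_proj hw, ← hvu n]
  rfl

theorem exists_of_memDQ {f : V → ℝ} (hf : G.MemDQ f) :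
    ∃ w ∈ G.formSpace, (w : V ⊕ V × V → ℝ) = G.embed f := by
  obtain ⟨u, hu, hlim⟩ := hf
  let v : ℕ → lp (fun _ : V ⊕ V × V => ℝ) 2 := fun n => ⟨G.embed (u n), G.embed_memℓp (hu n)⟩
  have hfin : ∀ᶠ n in atTop, G.formNormSq (u n - f) < 1 :=
    hlim.eventually (gt_mem_nhds zero_lt_one)
  obtain ⟨N, hN⟩ := hfin.exists
  have hmem : Memℓp (G.embed f) 2 := by
    have h1 : Memℓp (G.embed (u N - f)) 2 := by
      rw [memℓp_two_iff]
      rw [formNormSq_eq] at hN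
      have := ENNReal.summable_toReal (hN.trans ENNReal.one_lt_top).ne
      exact this.congr fun i => ENNReal.toReal_ofReal (sq_nonneg _)
    have h2 := (G.embed_memℓp (hu N)).sub h1
    rwa [← embed_sub, sub_sub_cancel] at h2
  let w : lp (fun _ : V ⊕ V × V => ℝ) 2 := ⟨G.embed f, hmem⟩
  refine ⟨w, ?_, rfl⟩
  refine mem_closure_of_tendsto (f := v) (b := atTop) ?_
    (Eventually.of_forall fun n => ⟨u n, hu n, rfl⟩)
  rw [tendsto_iff_norm_sub_tendsto_zero]
  have h1 : ∀ n, ENNReal.ofReal (‖v n - w‖ ^ 2) = G.formNormSq (u n - f) := by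
    intro n
    rw [ofReal_norm_sq_lp, formNormSq_eq, embed_sub]
    rfl
  have h2 := (ENNReal.tendsto_toReal ENNReal.zero_ne_top).comp
    (hlim.congr fun n => (h1 n).symm)
  have h3 := h2.sqrt
  simpa [Function.comp_def, ENNReal.toReal_ofReal, Real.sqrt_sq] using h3

open Classical in
/-- The point mass at `x`, embedded. -/
noncomputable def pt (x : V) : lp (fun _ : V ⊕ V × V => ℝ) 2 :=
  ⟨G.embed (Pi.single x 1), G.embed_memℓp ((Set.finite_singleton x).subset (by
    intro y hy
    by_contra h
    exact hy (Pi.single_eq_of_ne h 1)))⟩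

theorem pt_mem_core (x : V) : G.pt x ∈ G.core := by
  classical
  refine ⟨_, ?_, rfl⟩
  refine (Set.finite_singleton x).subset ?_
  intro y hy
  by_contra h
  exact hy (Pi.single_eq_of_ne h 1)

theorem pt_mem (x : V) : G.pt x ∈ G.formSpace :=
  G.core.le_topologicalClosure (G.pt_mem_core x)

open Classical in
theorem hasSum_embed_inl (f : V → ℝ) (x : V) :
    HasSum (fun y => G.embed f (Sum.inl y) * G.embed (Pi.single x 1) (Sum.inl y))
      (G.m x * f x) := by
  have h : G.m x * f x = G.embed f (Sum.inl x) * G.embed (Pi.single x 1) (Sum.inl x) := by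
    simp only [embed, Sum.elim_inl, Pi.single_eq_same]
    linear_combination (-f x) * Real.mul_self_sqrt (G.m_pos x).le
  rw [h]
  refine hasSum_single x fun y hy => ?_
  simp [embed, Pi.single_eq_of_ne hy]

open Classical in
theorem hasSum_embed_inr (f : V → ℝ) (x : V) :
    HasSum (fun p => G.embed f (Sum.inr p) * G.embed (Pi.single x 1) (Sum.inr p))
      (-∑ y ∈ G.nbrs x, G.μ x y * (f y - f x)) := by
  set a : V × V → ℝ := fun p => G.μ p.1 p.2 / 2 * (f p.2 - f p.1) with ha
  set c : ℝ := ∑ y ∈ G.nbrs x, G.μ x y * (f y - f x) with hc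
  have hA : HasSum (fun p : V × V => a p * (Pi.single x 1 : V → ℝ) p.2) (- c / 2) := by
    have hinj : Function.Injective (fun y : V => (y, x)) := fun _ _ h => (Prod.ext_iff.1 h).1
    refine (hinj.hasSum_iff ?_).1 ?_
    · rintro ⟨y, z⟩ hp
      have hne : z ≠ x := by
        rintro rfl
        exact hp ⟨_, rfl⟩
      simp [Pi.single_eq_of_ne hne]
    · have hval : - c / 2 = ∑ y ∈ G.nbrs x, a (y, x) := by
        rw [hc, neg_div, Finset.sum_div, ← Finset.sum_neg_distrib]
        refine Finset.sum_congr rfl fun y _ => ?_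
        simp only [ha]
        rw [G.μ_symm y x]; ring
      rw [hval]
      have hfun : ((fun p : V × V => a p * (Pi.single x 1 : V → ℝ) p.2) ∘ fun y => (y, x)) =
          fun y => a (y, x) := by
        funext y; simp
      rw [hfun]
      refine hasSum_sum_of_ne_finset_zero fun y hy => ?_
      have hn : ¬ G.Adj x y := fun h => hy (G.mem_nbrs.2 h)
      have h0 := G.μ_eq_zero x y hn
      simp [ha, G.μ_symm y x, h0]
  have hB : HasSum (fun p : V × V => a p * (Pi.single x 1 : V → ℝ) p.1) (c / 2) := by
    have hinj : Function.Injective (fun y : V => (x, y)) := fun _ _ h => (Prod.ext_iff.1 h).2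
    refine (hinj.hasSum_iff ?_).1 ?_
    · rintro ⟨y, z⟩ hp
      have hne : y ≠ x := by
        rintro rfl
        exact hp ⟨_, rfl⟩
      simp [Pi.single_eq_of_ne hne]
    · have hval : c / 2 = ∑ y ∈ G.nbrs x, a (x, y) := by
        rw [hc, Finset.sum_div]
        refine Finset.sum_congr rfl fun y _ => ?_
        simp only [ha]
        ring
      rw [hval]
      have hfun : ((fun p : V × V => a p * (Pi.single x 1 : V → ℝ) p.1) ∘ fun y => (x, y)) =
          fun y => a (x, y) := by
        funext y; simp
      rw [hfun]
      refine hasSum_sum_of_ne_finset_zero fun y hy => ?_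
      have hn : ¬ G.Adj x y := fun h => hy (G.mem_nbrs.2 h)
      have h0 := G.μ_eq_zero x y hn
      simp [ha, h0]
  have h := hA.sub hB
  rw [show - c / 2 - c / 2 = - c by ring] at h
  refine h.congr_fun fun p => ?_
  have hs := Real.mul_self_sqrt (div_nonneg (G.μ_nonneg p.1 p.2) zero_le_two)
  simp only [embed, Sum.elim_inr, ha]
  linear_combination ((f p.2 - f p.1) *
    ((Pi.single x 1 : V → ℝ) p.2 - (Pi.single x 1 : V → ℝ) p.1)) * hs

/-- Green's formula against a point mass. -/
theorem inner_pt {w : lp (fun _ : V ⊕ V × V => ℝ) 2} {f : V → ℝ}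
    (hw : (w : V ⊕ V × V → ℝ) = G.embed f) (x : V) :
    inner ℝ w (G.pt x) = G.m x * (f x - G.laplacian f x) := by
  have h3 := HasSum.sum (f := fun i => G.embed f i * G.pt x i) (G.hasSum_embed_inl f x)
    (G.hasSum_embed_inr f x)
  have h4 : inner ℝ w (G.pt x) = ∑' i, G.embed f i * G.pt x i := by
    rw [lp.inner_eq_tsum, hw]
    exact tsum_congr fun i => mul_comm _ _
  rw [h4, h3.tsum_eq, laplacian]
  have := (G.m_pos x).ne'
  field_simp
  ring

theorem core_le_span : G.core ≤ Submodule.span ℝ (Set.range G.pt) := by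
  classical
  rintro w ⟨f, hf, hw⟩
  have : w = ∑ x ∈ hf.toFinset, f x • G.pt x := by
    have hfs : f = ∑ x ∈ hf.toFinset, f x • (Pi.single x 1 : V → ℝ) := by
      funext y
      rw [Finset.sum_apply]
      by_cases hy : f y = 0
      · rw [hy, Finset.sum_eq_zero]
        intro x hx
        have : y ≠ x := by rintro rfl; simp [hy] at hx
        simp [Pi.single_eq_of_ne this]
      · rw [Finset.sum_eq_single y]
        · simp
        · intro x _ hx
          simp [Pi.single_eq_of_ne hx.symm]
        · intro h; simp [hy] at h
    let L : (V → ℝ) →ₗ[ℝ] (V ⊕ V × V → ℝ) :=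
      { toFun := G.embed, map_add' := G.embed_add, map_smul' := G.embed_smul }
    refine lp.ext ?_
    rw [hw, lp.coeFn_sum]
    conv_lhs => rw [hfs]
    change L _ = _
    rw [map_sum]
    refine Finset.sum_congr rfl fun x _ => ?_
    rw [map_smul, lp.coeFn_smul]
    congr 1
  rw [this]
  exact Submodule.sum_mem _ fun x _ => Submodule.smul_mem _ _ (Submodule.subset_span ⟨x, rfl⟩)

/-- The inclusion of the form space into `ℓ²(V, m)`. -/
noncomputable def incl : G.formSpace →L[ℝ] G.Ell2 := G.proj.comp G.formSpace.subtypeL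

/-- The resolvent `(1 - Δ)⁻¹`. -/
noncomputable def resolvent : G.Ell2 →L[ℝ] G.Ell2 :=
  G.incl.comp (ContinuousLinearMap.adjoint G.incl)

theorem inner_pt_right (g : G.Ell2) (x : V) : inner ℝ g (G.proj (G.pt x)) = G.m x * g x := by
  classical
  have h : ∀ y, G.proj (G.pt x) y = (Pi.single x 1 : V → ℝ) y := by
    intro y
    rw [proj_apply]
    have : G.pt x (Sum.inl y) = √(G.m y) * (Pi.single x 1 : V → ℝ) y := by
      simp only [pt, embed, Sum.elim_inl]
    rw [this, mul_div_cancel_left₀ _ (Real.sqrt_pos.2 (G.m_pos y)).ne']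
  rw [Ell2.inner_def, tsum_eq_single x]
  · rw [h]; simp
  · intro y hy
    rw [h, Pi.single_eq_of_ne hy]; simp

theorem resolvent_eq_iff (f g : G.Ell2) :
    G.resolvent g = f ↔ G.MemDQ f ∧ ∀ x, f x - G.laplacian f x = g x := by
  set w := ContinuousLinearMap.adjoint G.incl g with hw
  have hwin : ∀ v : G.formSpace, inner ℝ (w : lp (fun _ : V ⊕ V × V => ℝ) 2) v =
      inner ℝ g (G.proj v) := fun v =>
    ContinuousLinearMap.adjoint_inner_left G.incl v g
  constructor
  · rintro rfl
    refine ⟨G.memDQ_of_mem w.2, fun x => ?_⟩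
    have h1 := G.inner_pt (G.embed_proj w.2) x
    have h2 := hwin ⟨G.pt x, G.pt_mem x⟩
    rw [h1, inner_pt_right] at h2
    exact mul_left_cancel₀ (G.m_pos x).ne' h2
  · rintro ⟨hf, hfg⟩
    obtain ⟨v, hv, hvf⟩ := G.exists_of_memDQ hf
    have hproj : G.proj v = f := by
      refine Ell2.ext fun x => ?_
      rw [proj_apply, hvf]
      exact mul_div_cancel_left₀ _ (Real.sqrt_pos.2 (G.m_pos x)).ne'
    have horth : ∀ x, inner ℝ (v - w) (G.pt x) = 0 := by
      intro x
      have h2 := hwin ⟨G.pt x, G.pt_mem x⟩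
      rw [inner_sub_left, G.inner_pt hvf, h2, inner_pt_right, hfg, sub_self]
    have horth2 : ∀ u ∈ G.formSpace, inner ℝ (v - w) u = 0 := by
      intro u hu
      have hle : G.formSpace ≤ (ℝ ∙ (v - (w : lp (fun _ : V ⊕ V × V => ℝ) 2)))ᗮ := by
        refine Submodule.topologicalClosure_minimal _ (G.core_le_span.trans ?_)
          (Submodule.isClosed_orthogonal _)
        rw [Submodule.span_le]
        rintro _ ⟨x, rfl⟩
        exact Submodule.mem_orthogonal_singleton_iff_inner_right.2 (horth x)
      exact Submodule.mem_orthogonal_singleton_iff_inner_right.1 (hle hu)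
    have h0 := horth2 (v - w) (G.formSpace.sub_mem hv w.2)
    rw [inner_self_eq_zero, sub_eq_zero] at h0
    rw [← hproj, h0]
    rfl

theorem exists_isHeatSemigroup : ∃ P, G.IsHeatSemigroup P := by
  have hsym : ∀ u v, inner ℝ (G.resolvent u) v = inner ℝ u (G.resolvent v) := by
    intro u v
    simp only [resolvent, ContinuousLinearMap.comp_apply]
    rw [← ContinuousLinearMap.adjoint_inner_right, ContinuousLinearMap.adjoint_inner_left]
  have hle : ∀ w : G.formSpace, ‖G.incl w‖ ≤ ‖w‖ := by
    intro w
    refine (LinearMap.mkContinuous_norm_le _ zero_le_one _ : ‖G.proj‖ ≤ 1) |> fun h => ?_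
    have := G.proj.le_of_opNorm_le h w
    rwa [one_mul] at this
  have hpos : ∀ u, ‖G.resolvent u‖ ^ 2 ≤ inner ℝ (G.resolvent u) u := by
    intro u
    have h1 : inner ℝ (G.resolvent u) u = ‖ContinuousLinearMap.adjoint G.incl u‖ ^ 2 := by
      rw [← real_inner_self_eq_norm_sq, ContinuousLinearMap.adjoint_inner_right]
      rfl
    rw [h1]
    gcongr
    exact hle _
  have hinj : ∀ g, G.resolvent g = 0 → g = 0 := by
    intro g hg
    have h := ((G.resolvent_eq_iff 0 g).1 hg).2
    refine Ell2.ext fun x => ?_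
    rw [← h x]
    have h0 : ((0 : G.Ell2) : V → ℝ) = 0 := rfl
    simp [h0, laplacian]
  have hdense : DenseRange G.resolvent := by
    have h1 : (G.resolvent : G.Ell2 →ₗ[ℝ] G.Ell2).range.topologicalClosure = ⊤ := by
      rw [Submodule.topologicalClosure_eq_top_iff, Submodule.eq_bot_iff]
      intro g hg
      apply hinj
      rw [← inner_self_eq_zero (𝕜 := ℝ), hsym]
      exact Submodule.inner_left_of_mem_orthogonal
        (LinearMap.mem_range_self (G.resolvent : G.Ell2 →ₗ[ℝ] G.Ell2) (G.resolvent g)) hg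
    have h2 := Submodule.dense_iff_topologicalClosure_eq_top.2 h1
    rwa [LinearMap.coe_range] at h2
  obtain ⟨T, h0, hadd, hlim, hgen⟩ := exists_semigroup_of_resolvent G.resolvent hsym hpos hdense
  refine ⟨T, h0, hadd, hlim, fun f h => (hgen f h).trans ?_⟩
  constructor
  · rintro ⟨g, hg, rfl⟩
    obtain ⟨h1, h2⟩ := (G.resolvent_eq_iff f g).1 hg
    have h3 : ∀ x, G.laplacian f x = (G.resolvent g - g) x := by
      intro x
      rw [Ell2.sub_apply, hg, ← h2 x]; ring
    refine ⟨⟨h1, ?_⟩, h3⟩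
    rw [show G.laplacian f = (G.resolvent g - g : G.Ell2) from funext h3]
    exact Ell2.mem _
  · rintro ⟨⟨h1, -⟩, h3⟩
    have hg : G.resolvent (f - h) = f := by
      refine (G.resolvent_eq_iff f (f - h)).2 ⟨h1, fun x => ?_⟩
      rw [h3, Ell2.sub_apply]
    exact ⟨f - h, hg, by rw [hg]; abel⟩

end existence

/-- The heat semigroup `e^{tΔ}` on `ℓ²(V, m)`, for `t ≥ 0`. -/
noncomputable def heatSemigroup : ℝ → G.Ell2 →L[ℝ] G.Ell2 :=
  Classical.choose G.exists_isHeatSemigroup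

theorem isHeatSemigroup_heatSemigroup : G.IsHeatSemigroup G.heatSemigroup :=
  Classical.choose_spec G.exists_isHeatSemigroup

open Classical in
/-- `P_t f` for a function `f` in `ℓ²(V, m)`. -/
noncomputable def heat (t : ℝ) (f : V → ℝ) : V → ℝ :=
  if hf : G.MemEll2 f then (G.heatSemigroup t ⟨f, hf⟩ : G.Ell2) else 0

end WeightedGraph

/-- The constant `(1 - e^{-2Kt}) / K`, with its limiting value `2t` for `K = 0`. -/
noncomputable def poincareConst (K t : ℝ) : ℝ :=
  if K = 0 then 2 * t else (1 - Real.exp (-2 * K * t)) / K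

/-! ### Pointwise calculus of Δ and Γ, finite-support summation, the Caccioppoli inequality and
cutoffs. -/

namespace WeightedGraph

variable {V : Type u} (G : WeightedGraph V)

/-! The implication (a) ⇒ (b) is an interpolation along the semigroup. For u = P_{t-s} f and a
nonnegative test function h in D(Δ), put φ(s) = ⟨P_s h, u²⟩ and ψ(s) = ⟨P_s h, Γ(u)⟩. Formally,
Δ(u²) = 2uΔu + 2Γ(u) gives φ' = 2ψ, and ψ' = 2⟨P_s h, Γ₂(u)⟩, so that the curvature condition reads
ψ' ≥ 2Kψ. The Grönwall argument `sub_le_poincareConst_mul` bounds φ(t) - φ(0) by the Poincaré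
constant times ψ(t). Taking for h a normalised point mass at x and moving P_t across the inner
product yields the inequality at x.

The difficulty is to move Δ from P_s h onto u² or Γ(u), which need not lie in D(Δ). Only
inequalities are needed, and `LapTo.inner_le_of_subsolution` supplies them: if g, F are in ℓ², F ≤
Δg and gF ≤ gΔg, then ⟨h, F⟩ ≤ ⟨Δh, g⟩ for nonnegative h in D(Δ). Completeness enters through the
cutoffs η_k. By `caccioppoli` the functions η_k g stay bounded in the form norm, while η_n² h tends
to h in that norm by `tendsto_norm_cutoff`. The nonnegativity of P_s h is `LapTo.heat_nonneg`: the
ℓ² norm of the negative part decreases along the flow, again by Caccioppoli.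

Nondegeneracy of m embeds ℓ² into ℓ^∞, so the product is bounded and bilinear on ℓ² and Γ is bounded
and bilinear from the form space into ℓ² (`Nondegenerate.exists_mul`, `Nondegenerate.exists_gamma`).
Hence φ and ψ are differentiable, and both sides of the Poincaré inequality are continuous in the
form norm, which gives (b) ⇒ (c) by density.

For (b) ⇒ (a), expand at t = 0. The terms of order zero and one cancel, and the coefficient of t² in
the right side minus the left side is 2(Γ₂(f) - KΓ(f)). Since Γ₂(f)(x) depends on f only within
distance two of x, finitely supported f suffice. -/

theorem m_mul_laplacian (f : V → ℝ) (x : V) :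
    G.m x * G.laplacian f x = ∑ y ∈ G.nbrs x, G.μ x y * (f y - f x) := by
  rw [laplacian, ← mul_assoc, mul_one_div_cancel (G.m_pos x).ne', one_mul]

theorem m_mul_gamma (f g : V → ℝ) (x : V) :
    G.m x * G.gamma f g x = ∑ y ∈ G.nbrs x, G.μ x y / 2 * ((f y - f x) * (g y - g x)) := by
  have h : G.m x * G.gamma f g x = 1 / 2 * (G.m x * G.laplacian (f * g) x
      - f x * (G.m x * G.laplacian g x) - g x * (G.m x * G.laplacian f x)) := by
    rw [gamma]; ring
  rw [h, m_mul_laplacian, m_mul_laplacian, m_mul_laplacian, Finset.mul_sum, Finset.mul_sum,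
    ← Finset.sum_sub_distrib, ← Finset.sum_sub_distrib, Finset.mul_sum]
  refine Finset.sum_congr rfl fun y _ => ?_
  simp only [Pi.mul_apply]
  ring

theorem laplacian_mul (f g : V → ℝ) (x : V) :
    G.laplacian (f * g) x =
      f x * G.laplacian g x + g x * G.laplacian f x + 2 * G.gamma f g x := by
  rw [gamma]; ring

theorem gamma_self_nonneg (f : V → ℝ) (x : V) : 0 ≤ G.gamma f f x := by
  have h : 0 ≤ G.m x * G.gamma f f x := by
    rw [m_mul_gamma]
    exact Finset.sum_nonneg fun y _ =>
      mul_nonneg (div_nonneg (G.μ_nonneg x y) zero_le_two) (mul_self_nonneg _)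
  exact nonneg_of_mul_nonneg_right h (G.m_pos x)

theorem laplacian_add (f g : V → ℝ) (x : V) :
    G.laplacian (f + g) x = G.laplacian f x + G.laplacian g x := by
  simp only [laplacian, Pi.add_apply, ← mul_add, ← Finset.sum_add_distrib]
  congr 1
  exact Finset.sum_congr rfl fun y _ => by ring

theorem laplacian_smul (c : ℝ) (f : V → ℝ) (x : V) :
    G.laplacian (c • f) x = c * G.laplacian f x := by
  simp only [laplacian, Pi.smul_apply, smul_eq_mul, Finset.mul_sum]
  exact Finset.sum_congr rfl fun y _ => by ring

theorem laplacian_sub (f g : V → ℝ) (x : V) :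
    G.laplacian (f - g) x = G.laplacian f x - G.laplacian g x := by
  rw [show f - g = f + (-1 : ℝ) • g by simp [sub_eq_add_neg], laplacian_add, laplacian_smul]
  ring

theorem laplacian_neg (f : V → ℝ) (x : V) :
    G.laplacian (-f) x = - G.laplacian f x := by
  rw [show -f = (-1 : ℝ) • f by simp, laplacian_smul]
  ring

theorem laplacian_congr {f g : V → ℝ} {x : V} (hx : f x = g x)
    (h : ∀ y ∈ G.nbrs x, f y = g y) : G.laplacian f x = G.laplacian g x := by
  simp only [laplacian]
  congr 1
  exact Finset.sum_congr rfl fun y hy => by rw [h y hy, hx]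

theorem gamma_congr {f g f' g' : V → ℝ} {x : V} (hx : f x = f' x) (hx' : g x = g' x)
    (h : ∀ y ∈ G.nbrs x, f y = f' y) (h' : ∀ y ∈ G.nbrs x, g y = g' y) :
    G.gamma f g x = G.gamma f' g' x := by
  have hm : G.laplacian (f * g) x = G.laplacian (f' * g') x :=
    G.laplacian_congr (by simp [hx, hx']) fun y hy => by simp [h y hy, h' y hy]
  rw [gamma, gamma, hm, G.laplacian_congr hx h, G.laplacian_congr hx' h', hx, hx']

theorem mem_nbrs_comm {x y : V} : y ∈ G.nbrs x ↔ x ∈ G.nbrs y := by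
  rw [mem_nbrs, mem_nbrs]
  exact ⟨G.adj_symm x y, G.adj_symm y x⟩

/-- The Laplacian preserves finite support. -/
theorem finite_support_laplacian {f : V → ℝ} (hf : (Function.support f).Finite) :
    (Function.support (G.laplacian f)).Finite := by
  classical
  refine (hf.union (hf.biUnion fun x _ => (G.nbrs x).finite_toSet)).subset fun x hx => ?_
  by_contra hn
  apply hx
  simp only [Set.mem_union, Set.mem_iUnion, not_or, not_exists, Function.mem_support, not_not]
    at hn
  rw [laplacian, Finset.sum_eq_zero, mul_zero]
  intro y hy
  have : f y = 0 := by
    by_contra h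
    exact hn.2 y h (G.mem_nbrs_comm.1 hy)
  rw [this, hn.1]; ring

theorem finite_support_gamma {f : V → ℝ} (hf : (Function.support f).Finite) (g : V → ℝ) :
    (Function.support (G.gamma f g)).Finite := by
  refine (hf.union (G.finite_support_laplacian hf |>.union
    (G.finite_support_laplacian (f := f * g) (hf.subset (by
      intro x hx; simp only [Function.mem_support, Pi.mul_apply] at hx ⊢
      exact left_ne_zero_of_mul hx))))).subset fun x hx => ?_
  by_contra hn
  apply hx
  simp only [Set.mem_union, not_or, Function.mem_support, not_not] at hn
  rw [gamma, hn.1, hn.2.1, hn.2.2]; ring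

theorem memEll2_of_finite {f : V → ℝ} (hf : (Function.support f).Finite) : G.MemEll2 f :=
  summable_of_hasFiniteSupport (hf.subset fun x hx => by
    intro h; apply hx; simp [h])

/-- A finite set containing the closed neighbourhood of a finite support. -/
theorem exists_finset_nbhd {f : V → ℝ} (hf : (Function.support f).Finite) :
    ∃ S : Finset V, ∀ x, f x ≠ 0 → x ∈ S ∧ G.nbrs x ⊆ S := by
  classical
  refine ⟨hf.toFinset ∪ hf.toFinset.biUnion G.nbrs, fun x hx => ⟨?_, ?_⟩⟩
  · exact Finset.mem_union_left _ (by simpa using hx)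
  · exact (Finset.subset_biUnion_of_mem G.nbrs (by simpa using hx)).trans
      Finset.subset_union_right

theorem m_mul_laplacian_of_subset {S : Finset V} {x : V} (h : G.nbrs x ⊆ S) (f : V → ℝ) :
    G.m x * G.laplacian f x = ∑ y ∈ S, G.μ x y * (f y - f x) := by
  rw [m_mul_laplacian]
  refine Finset.sum_subset h fun y _ hy => ?_
  rw [G.μ_eq_zero x y (fun h => hy (G.mem_nbrs.2 h)), zero_mul]

theorem tsum_mul_laplacian {S : Finset V} {a : V → ℝ}
    (hS : ∀ x, a x ≠ 0 → x ∈ S ∧ G.nbrs x ⊆ S) (b : V → ℝ) :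
    ∑' x, G.m x * (a x * G.laplacian b x) =
      ∑ x ∈ S, ∑ y ∈ S, G.μ x y * (a x * (b y - b x)) := by
  rw [tsum_eq_sum (s := S)]
  · refine Finset.sum_congr rfl fun x _ => ?_
    by_cases hx : a x = 0
    · simp [hx]
    · rw [mul_left_comm, G.m_mul_laplacian_of_subset (hS x hx).2, Finset.mul_sum]
      exact Finset.sum_congr rfl fun y _ => by ring
  · intro x hx
    have : a x = 0 := by
      by_contra h
      exact hx (hS x h).1
    simp [this]

/-- A double sum against symmetric weights often has a sign only after each term is averaged with
its transpose; the sign can then be checked pair by pair. -/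
theorem sum_symmetrize (S : Finset V) (F : V → V → ℝ) :
    ∑ x ∈ S, ∑ y ∈ S, F x y = ∑ x ∈ S, ∑ y ∈ S, (F x y + F y x) / 2 := by
  have h : ∑ x ∈ S, ∑ y ∈ S, F x y = ∑ x ∈ S, ∑ y ∈ S, F y x := Finset.sum_comm
  have h2 : ∑ x ∈ S, ∑ y ∈ S, (F x y + F y x) / 2 =
      (∑ x ∈ S, ∑ y ∈ S, F x y + ∑ x ∈ S, ∑ y ∈ S, F y x) / 2 := by
    simp only [← Finset.sum_add_distrib, Finset.sum_div]
  rw [h2, ← h]; ring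

/-- The Laplacian is dissipative on finitely supported functions. -/
theorem tsum_mul_laplacian_self_nonpos {a : V → ℝ} (ha : (Function.support a).Finite) :
    ∑' x, G.m x * (a x * G.laplacian a x) ≤ 0 := by
  obtain ⟨S, hS⟩ := G.exists_finset_nbhd ha
  rw [G.tsum_mul_laplacian hS, sum_symmetrize]
  refine Finset.sum_nonpos fun x _ => Finset.sum_nonpos fun y _ => ?_
  rw [G.μ_symm y x]
  nlinarith [mul_nonneg (G.μ_nonneg x y) (sq_nonneg (a x - a y))]

/-- Caccioppoli inequality for a cutoff function `η`. -/
theorem caccioppoli {η : V → ℝ} (hη : (Function.support η).Finite) {c : ℝ} (hc : 0 ≤ c)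
    (hηc : ∀ x, G.gamma η η x ≤ c) {g : V → ℝ} (hg : G.MemEll2 g) :
    - ∑' x, G.m x * ((η x * g x) * G.laplacian (η * g) x) ≤
      - ∑' x, G.m x * ((η x ^ 2 * g x) * G.laplacian g x) + c * ∑' x, G.m x * g x ^ 2 := by
  obtain ⟨S, hS⟩ := G.exists_finset_nbhd hη
  have hS1 : ∀ x, η x * g x ≠ 0 → x ∈ S ∧ G.nbrs x ⊆ S := fun x hx =>
    hS x (left_ne_zero_of_mul hx)
  have hS2 : ∀ x, η x ^ 2 * g x ≠ 0 → x ∈ S ∧ G.nbrs x ⊆ S := fun x hx =>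
    hS x (fun h => left_ne_zero_of_mul hx (by simp [h]))
  rw [G.tsum_mul_laplacian hS1, G.tsum_mul_laplacian hS2]
  have h1 : ∑ x ∈ S, ∑ y ∈ S, G.μ x y / 2 * (g x ^ 2 * (η y - η x) ^ 2) ≤
      c * ∑' x, G.m x * g x ^ 2 := by
    have hS' : ∑ x ∈ S, G.m x * g x ^ 2 ≤ ∑' x, G.m x * g x ^ 2 :=
      hg.sum_le_tsum S fun x _ => mul_nonneg (G.m_pos x).le (sq_nonneg _)
    refine le_trans ?_ (mul_le_mul_of_nonneg_left hS' hc)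
    rw [Finset.mul_sum]
    refine Finset.sum_le_sum fun x _ => ?_
    have h2 : ∑ y ∈ S, G.μ x y / 2 * (η y - η x) ^ 2 ≤ G.m x * G.gamma η η x := by
      classical
      rw [m_mul_gamma]
      have h3 : ∑ y ∈ S, G.μ x y / 2 * (η y - η x) ^ 2 =
          ∑ y ∈ S ∩ G.nbrs x, G.μ x y / 2 * ((η y - η x) * (η y - η x)) := by
        rw [← Finset.sum_ite_mem]
        refine Finset.sum_congr rfl fun y _ => ?_
        split_ifs with hy
        · ring
        · rw [G.μ_eq_zero x y (fun h => hy (G.mem_nbrs.2 h))]; ring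
      rw [h3]
      exact Finset.sum_le_sum_of_subset_of_nonneg Finset.inter_subset_right fun y _ _ =>
        mul_nonneg (div_nonneg (G.μ_nonneg x y) zero_le_two) (mul_self_nonneg _)
    calc ∑ y ∈ S, G.μ x y / 2 * (g x ^ 2 * (η y - η x) ^ 2)
        = g x ^ 2 * ∑ y ∈ S, G.μ x y / 2 * (η y - η x) ^ 2 := by
          rw [Finset.mul_sum]
          exact Finset.sum_congr rfl fun y _ => by ring
      _ ≤ g x ^ 2 * (G.m x * c) := mul_le_mul_of_nonneg_left
          (h2.trans (mul_le_mul_of_nonneg_left (hηc x) (G.m_pos x).le)) (sq_nonneg _)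
      _ = c * (G.m x * g x ^ 2) := by ring
  refine le_trans ?_ (add_le_add_right h1 _)
  rw [← sub_nonneg, ← Finset.sum_neg_distrib, ← Finset.sum_neg_distrib,
    ← Finset.sum_add_distrib, ← Finset.sum_sub_distrib]
  simp only [← Finset.sum_neg_distrib, ← Finset.sum_add_distrib, ← Finset.sum_sub_distrib]
  rw [sum_symmetrize]
  refine Finset.sum_nonneg fun x _ => Finset.sum_nonneg fun y _ => ?_
  rw [G.μ_symm y x]
  -- The exact commutator term is μ/2 · g x · g y · (η y - η x)². Replacing g x g y by the mean of g
  -- x² and g y² leaves precisely this square as the slack for each pair.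
  have h4 : 0 ≤ G.μ x y / 4 * ((g x - g y) ^ 2 * (η y - η x) ^ 2) := by
    have := G.μ_nonneg x y
    positivity
  simp only [Pi.mul_apply]
  linarith

/-- The cutoff functions of a complete graph are uniformly bounded. -/
theorem IsComplete.exists_cutoff (hG : G.IsComplete) :
    ∃ (η : ℕ → V → ℝ) (B : ℝ), (∀ k, (Function.support (η k)).Finite) ∧
      (∀ k x, |η k x| ≤ B) ∧ (∀ x, Tendsto (fun k => η k x) atTop (𝓝 1)) ∧
      ∀ k x, G.gamma (η k) (η k) x ≤ 1 / ((k : ℝ) + 1) := by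
  obtain ⟨η, hfin, hmono, hlim, hΓ⟩ := hG
  -- `η 0` takes finitely many values, hence is bounded below; monotonicity hands this bound to
  -- every cutoff, and the limit 1 bounds them above. The shift by one index below puts every cutoff
  -- in the range where the gradient bound is assumed.
  obtain ⟨C, hC⟩ : ∃ C, ∀ x, -C ≤ η 0 x := by
    have hr : (Set.range (η 0)).Finite := by
      refine (((hfin 0).image (η 0)).union (Set.finite_singleton 0)).subset ?_
      rintro _ ⟨x, rfl⟩
      by_cases h : η 0 x = 0
      · right; exact h
      · left; exact ⟨x, h, rfl⟩
    obtain ⟨c, hc⟩ := hr.bddBelow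
    exact ⟨-c, fun x => by simpa using hc ⟨x, rfl⟩⟩
  refine ⟨fun k => η (k + 1), max C 1,
    fun k => hfin _, fun k x => abs_le.2 ⟨?_, ?_⟩, fun x => (tendsto_add_atTop_iff_nat 1).2 (hlim x),
    fun k x => by exact_mod_cast hΓ (k + 1) (by omega) x⟩
  · have := hmono (Nat.zero_le (k + 1)) x
    linarith [hC x, le_max_left C 1]
  · have hm : Monotone fun k => η k x := fun i j h => hmono h x
    exact (hm.ge_of_tendsto (hlim x) _).trans (le_max_right _ _)

end WeightedGraph

/-! ### Orbits of strongly continuous semigroups: boundedness, continuity, derivatives, second-order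
expansion. -/

/-- A strongly continuous semigroup of bounded operators. -/
structure IsC0Semigroup {H : Type*} [NormedAddCommGroup H] [NormedSpace ℝ H]
    (P : ℝ → H →L[ℝ] H) : Prop where
  zero : P 0 = 1
  add : ∀ s t, 0 ≤ s → 0 ≤ t → P (s + t) = P s * P t
  tendsto_zero : ∀ f, Tendsto (fun t => P t f) (𝓝[>] 0) (𝓝 f)

/-- `h` is the image of `f` under the infinitesimal generator of `P`. -/
def GeneratorMapsTo {H : Type*} [NormedAddCommGroup H] [NormedSpace ℝ H]
    (P : ℝ → H →L[ℝ] H) (f h : H) : Prop :=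
  Tendsto (fun t : ℝ => t⁻¹ • (P t f - f)) (𝓝[>] 0) (𝓝 h)

theorem tendsto_sub_nhdsGT_zero (t : ℝ) : Tendsto (fun s => s - t) (𝓝[>] t) (𝓝[>] 0) := by
  refine tendsto_nhdsWithin_iff.2 ⟨?_, ?_⟩
  · have : Tendsto (fun s => s - t) (𝓝 t) (𝓝 (t - t)) := tendsto_id.sub_const t
    rw [sub_self] at this
    exact tendsto_nhdsWithin_of_tendsto_nhds this
  · filter_upwards [self_mem_nhdsWithin] with s hs
    exact sub_pos.2 (by simpa using hs)

namespace IsC0Semigroup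

variable {H : Type*} [NormedAddCommGroup H] [NormedSpace ℝ H] {P : ℝ → H →L[ℝ] H}

theorem add_apply (hP : IsC0Semigroup P) {s t : ℝ} (hs : 0 ≤ s) (ht : 0 ≤ t) (f : H) :
    P (s + t) f = P s (P t f) := by rw [hP.add s t hs ht]; rfl

theorem comm_apply (hP : IsC0Semigroup P) {s t : ℝ} (hs : 0 ≤ s) (ht : 0 ≤ t) (f : H) :
    P s (P t f) = P t (P s f) := by
  rw [← hP.add_apply hs ht, ← hP.add_apply ht hs, add_comm]

theorem zero_apply (hP : IsC0Semigroup P) (f : H) : P 0 f = f := by rw [hP.zero]; rfl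

/-- Otherwise there are times t_n → 0 with ‖P t_n‖ unbounded, although every orbit converges along
them; this contradicts Banach–Steinhaus. -/
theorem exists_bound_near_zero [CompleteSpace H] (hP : IsC0Semigroup P) :
    ∃ δ > 0, ∃ C : ℝ, 1 ≤ C ∧ ∀ t, 0 ≤ t → t ≤ δ → ‖P t‖ ≤ C := by
  by_contra! hcon
  have hn : ∀ n : ℕ, ∃ t, 0 ≤ t ∧ t ≤ 1 / ((n : ℝ) + 1) ∧ (n : ℝ) + 1 < ‖P t‖ := fun n =>
    hcon (1 / ((n : ℝ) + 1)) (by positivity) ((n : ℝ) + 1) (by linarith [n.cast_nonneg (α := ℝ)])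
  choose t ht0 htn hC using hn
  -- The time zero is excluded because P 0 has norm at most one; strong continuity is available only
  -- from the right of zero.
  have hne : ∀ n, 0 < t n := fun n => by
    refine lt_of_le_of_ne (ht0 n) fun h => ?_
    have h1 := hC n
    rw [← h, hP.zero] at h1
    have h2 : ‖(1 : H →L[ℝ] H)‖ ≤ 1 := ContinuousLinearMap.norm_id_le
    linarith [n.cast_nonneg (α := ℝ)]
  have hlim : Tendsto t atTop (𝓝[>] 0) := tendsto_nhdsWithin_iff.2
    ⟨squeeze_zero ht0 htn tendsto_one_div_add_atTop_nhds_zero_nat, Eventually.of_forall hne⟩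
  obtain ⟨C, hC'⟩ := banach_steinhaus (g := fun n => P (t n)) fun f => by
    obtain ⟨C, hC⟩ := (Metric.isBounded_range_of_tendsto _
      ((hP.tendsto_zero f).comp hlim)).exists_norm_le
    exact ⟨C, fun n => hC _ ⟨n, rfl⟩⟩
  obtain ⟨n, hn⟩ := exists_nat_gt C
  linarith [hC n, hC' n]

theorem exists_bound [CompleteSpace H] (hP : IsC0Semigroup P) (T : ℝ) :
    ∃ C : ℝ, ∀ t, 0 ≤ t → t ≤ T → ‖P t‖ ≤ C := by
  obtain ⟨δ, hδ, C, hC1, hC⟩ := hP.exists_bound_near_zero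
  -- Splitting off one step of length δ at a time costs a factor C each; C ≥ 1 makes the bound
  -- monotone in the number of steps.
  have key : ∀ (n : ℕ) (t : ℝ), 0 ≤ t → t ≤ (n + 1) * δ → ‖P t‖ ≤ C ^ (n + 1) := by
    intro n
    induction n with
    | zero => intro t h0 h1; simpa using hC t h0 (by simpa using h1)
    | succ n ih =>
      intro t h0 h1
      by_cases h : t ≤ δ
      · exact (hC t h0 h).trans (le_self_pow₀ hC1 (by omega))
      · push Not at h
        have e : P t = P (t - δ) * P δ := by
          rw [← hP.add _ _ (by linarith) hδ.le, sub_add_cancel]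
        rw [e, pow_succ]
        refine (ContinuousLinearMap.opNorm_comp_le _ _).trans ?_
        gcongr
        · refine ih _ (by linarith) ?_
          push_cast at h1
          linarith
        · exact hC δ hδ.le le_rfl
  obtain ⟨n, hn⟩ := exists_nat_gt (T / δ)
  refine ⟨C ^ (n + 1), fun t h0 h1 => key n t h0 ?_⟩
  rw [div_lt_iff₀ hδ] at hn
  nlinarith

theorem generator_apply (hP : IsC0Semigroup P) {f h : H} (hf : GeneratorMapsTo P f h) {t : ℝ}
    (ht : 0 ≤ t) : GeneratorMapsTo P (P t f) (P t h) := by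
  refine (((P t).continuous.tendsto h).comp hf).congr' ?_
  filter_upwards [self_mem_nhdsWithin] with s hs
  have hs' : 0 ≤ s := le_of_lt hs
  simp only [Function.comp_apply, map_smul, map_sub]
  rw [hP.comm_apply ht hs']

theorem tendsto_right (hP : IsC0Semigroup P) {t : ℝ} (ht : 0 ≤ t) (f : H) :
    Tendsto (fun s => P s f) (𝓝[>] t) (𝓝 (P t f)) := by
  have hsub := tendsto_sub_nhdsGT_zero t
  refine (((P t).continuous.tendsto f).comp ((hP.tendsto_zero f).comp hsub)).congr' ?_
  filter_upwards [self_mem_nhdsWithin] with s hs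
  have hs' : 0 ≤ s - t := (sub_pos.2 (Set.mem_Ioi.1 hs)).le
  simp only [Function.comp_apply]
  rw [← hP.add_apply ht hs', add_sub_cancel]

theorem hasDerivWithinAt_right (hP : IsC0Semigroup P) {f h : H} (hf : GeneratorMapsTo P f h)
    {t : ℝ} (ht : 0 ≤ t) :
    HasDerivWithinAt (fun s => P s f) (P t h) (Set.Ici t) t := by
  rw [← hasDerivWithinAt_Ioi_iff_Ici, hasDerivWithinAt_iff_tendsto_slope' (by simp)]
  have hsub := tendsto_sub_nhdsGT_zero t
  refine ((hP.generator_apply hf ht).comp hsub).congr' ?_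
  filter_upwards [self_mem_nhdsWithin] with s hs
  have hs' : 0 ≤ s - t := (sub_pos.2 (Set.mem_Ioi.1 hs)).le
  simp only [Function.comp_apply, slope, vsub_eq_sub]
  rw [← hP.add_apply hs' ht, sub_add_cancel]

variable [CompleteSpace H]

/-- From P_t f = P_s P_{t-s} f, the difference P_t f - P_s f equals P_s(P_{t-s} f - f), and P_s is
uniformly bounded on [0, t]. -/
theorem tendsto_left (hP : IsC0Semigroup P) {t : ℝ} (ht : 0 < t) (f : H) :
    Tendsto (fun s => P s f) (𝓝[<] t) (𝓝 (P t f)) := by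
  obtain ⟨C, hC⟩ := hP.exists_bound t
  have hC0 : 0 ≤ C := (norm_nonneg _).trans (hC 0 le_rfl ht.le)
  have hsub : Tendsto (fun s => t - s) (𝓝[<] t) (𝓝[>] 0) := by
    refine tendsto_nhdsWithin_iff.2 ⟨?_, ?_⟩
    · have : Tendsto (fun s => t - s) (𝓝 t) (𝓝 (t - t)) := tendsto_id.const_sub t
      rw [sub_self] at this
      exact tendsto_nhdsWithin_of_tendsto_nhds this
    · filter_upwards [self_mem_nhdsWithin] with s hs
      exact sub_pos.2 (by simpa using hs)
  have h1 := (tendsto_iff_norm_sub_tendsto_zero.1 ((hP.tendsto_zero f).comp hsub)).const_mul C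
  rw [mul_zero] at h1
  rw [tendsto_iff_norm_sub_tendsto_zero]
  refine squeeze_zero' (Eventually.of_forall fun _ => norm_nonneg _) ?_ h1
  filter_upwards [Ioo_mem_nhdsLT ht] with s hs
  have e : P t f = P s (P (t - s) f) := by
    rw [← hP.add_apply hs.1.le (sub_pos.2 hs.2).le, add_sub_cancel]
  rw [e, ← map_sub, ← norm_neg, ← map_neg, neg_sub]
  exact (P s).le_of_opNorm_le (hC s hs.1.le hs.2.le) _

/-- Orbits, extended by a constant to negative times, are continuous. -/
theorem continuous_max (hP : IsC0Semigroup P) (f : H) : Continuous fun t => P (max t 0) f := by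
  have hm : Continuous fun t : ℝ => max t 0 := by fun_prop
  have hon : ContinuousOn (fun t => P t f) (Set.Ici 0) := by
    intro t ht
    rcases eq_or_lt_of_le (Set.mem_Ici.1 ht) with h | h
    · subst h
      rw [← continuousWithinAt_Ioi_iff_Ici]
      exact hP.tendsto_right le_rfl f
    · exact (continuousAt_iff_continuous_left'_right'.2
        ⟨hP.tendsto_left h f, hP.tendsto_right h.le f⟩).continuousWithinAt
  exact hon.comp_continuous hm fun t => Set.mem_Ici.2 (le_max_right _ _)

theorem continuousOn (hP : IsC0Semigroup P) (f : H) :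
    ContinuousOn (fun t => P t f) (Set.Ici 0) :=
  (hP.continuous_max f).continuousOn.congr fun t ht => by
    simp only [max_eq_left (Set.mem_Ici.1 ht)]

/-- The fundamental theorem of calculus requires only the right derivative. Since the truncated
integrand is continuous on all of ℝ, this integral formula upgrades the right derivative to the
two-sided one in `hasDerivAt`. -/
theorem apply_eq_integral (hP : IsC0Semigroup P) {f h : H} (hf : GeneratorMapsTo P f h)
    {t : ℝ} (ht : 0 ≤ t) : P t f = f + ∫ s in (0 : ℝ)..t, P (max s 0) h := by
  have := intervalIntegral.integral_eq_sub_of_hasDeriv_right_of_le (f := fun s => P s f)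
    (f' := fun s => P (max s 0) h) ht ((hP.continuousOn f).mono Set.Icc_subset_Ici_self)
    (fun s hs => by
      simp only [max_eq_left hs.1.le]
      exact (hP.hasDerivWithinAt_right hf hs.1.le).mono Set.Ioi_subset_Ici_self)
    ((hP.continuous_max h).intervalIntegrable _ _)
  rw [this, hP.zero_apply, add_sub_cancel]

theorem hasDerivAt (hP : IsC0Semigroup P) {f h : H} (hf : GeneratorMapsTo P f h)
    {t : ℝ} (ht : 0 < t) : HasDerivAt (fun s => P s f) (P t h) t := by
  have h1 : HasDerivAt (fun r => f + ∫ s in (0 : ℝ)..r, P (max s 0) h) (P (max t 0) h) t :=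
    ((hP.continuous_max h).integral_hasStrictDerivAt 0 t).hasDerivAt.const_add f
  rw [max_eq_left ht.le] at h1
  refine h1.congr_of_eventuallyEq ?_
  filter_upwards [Ioi_mem_nhds ht] with s hs
  exact hP.apply_eq_integral hf (le_of_lt hs)

/-- Second-order Taylor expansion of an orbit at time zero. -/
theorem tendsto_second_order (hP : IsC0Semigroup P) {f h k : H} (hf : GeneratorMapsTo P f h)
    (hh : GeneratorMapsTo P h k) :
    Tendsto (fun t : ℝ => (t ^ 2)⁻¹ • (P t f - f - t • h)) (𝓝[>] 0) (𝓝 ((1 / 2 : ℝ) • k)) := by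
  rw [Metric.tendsto_nhds]
  intro ε hε
  obtain ⟨δ, hδ, hb⟩ := (mem_nhdsGT_iff_exists_Ioo_subset.1
    ((Metric.tendsto_nhds.1 hh) ε hε))
  filter_upwards [Ioo_mem_nhdsGT hδ] with t ht
  -- The Taylor remainder of order two has right derivative P_s h - h - s k, of norm at most ε s for
  -- s < δ because k is the generator applied to h; integration gives ε t²/2.
  have hbound := image_norm_le_of_norm_deriv_right_le_deriv_boundary
    (f := fun s : ℝ => P s f - f - s • h - (s ^ 2 / 2) • k)
    (f' := fun s : ℝ => P s h - h - s • k) (a := 0) (b := t)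
    (B := fun s => ε * (s ^ 2 / 2)) (B' := fun s => ε * s)
    (by
      have h1 := (hP.continuousOn f).mono (t := Set.Icc 0 t) Set.Icc_subset_Ici_self
      exact ((h1.sub continuousOn_const).sub (by fun_prop)).sub (by fun_prop))
    (fun s hs => by
      have h1 := (hP.hasDerivWithinAt_right hf hs.1).sub_const f
      have h2 := ((hasDerivAt_id s).smul_const h).hasDerivWithinAt (s := Set.Ici s)
      have h3 := ((((hasDerivAt_id s).pow 2).div_const 2).smul_const k).hasDerivWithinAt
        (s := Set.Ici s)
      refine ((h1.sub h2).sub h3).congr_deriv ?_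
      simp)
    (by simp [hP.zero_apply])
    (fun s => by
      refine ((((hasDerivAt_id s).pow 2).div_const 2).const_mul ε).congr_deriv ?_
      simp)
    (fun s hs => by
      rcases eq_or_lt_of_le hs.1 with h0 | h0
      · subst h0; simp [hP.zero_apply]
      · have h1 : dist (s⁻¹ • (P s h - h)) k < ε := hb ⟨h0, hs.2.trans ht.2⟩
        rw [dist_eq_norm] at h1
        have e : P s h - h - s • k = s • (s⁻¹ • (P s h - h) - k) := by
          rw [smul_sub, smul_smul, mul_inv_cancel₀ h0.ne', one_smul]
        rw [e, norm_smul, Real.norm_eq_abs, abs_of_pos h0, mul_comm]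
        gcongr)
    (x := t) ⟨ht.1.le, le_rfl⟩
  have h0 : 0 < t ^ 2 := pow_pos ht.1 2
  have e : (t ^ 2)⁻¹ • (P t f - f - t • h) - (1 / 2 : ℝ) • k =
      (t ^ 2)⁻¹ • (P t f - f - t • h - (t ^ 2 / 2) • k) := by
    rw [smul_sub _ _ ((t ^ 2 / 2) • k), smul_smul]
    congr 2
    have := ht.1.ne'
    field_simp
  rw [dist_eq_norm, e, norm_smul, Real.norm_eq_abs, abs_of_pos (inv_pos.2 h0), inv_mul_lt_iff₀ h0]
  refine hbound.trans_lt ?_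
  nlinarith

end IsC0Semigroup

/-! ### The heat semigroup: domain of the generator, symmetry and positivity. -/

namespace WeightedGraph

variable {V : Type u} (G : WeightedGraph V)

/-- `f` is in the domain of the Laplacian, with image `h`. -/
def LapTo (f h : G.Ell2) : Prop := G.MemDQ f ∧ ∀ x, G.laplacian f x = h x

theorem isC0Semigroup_heatSemigroup : IsC0Semigroup G.heatSemigroup :=
  ⟨G.isHeatSemigroup_heatSemigroup.zero, G.isHeatSemigroup_heatSemigroup.add,
    G.isHeatSemigroup_heatSemigroup.tendsto_zero⟩

theorem generatorMapsTo_iff {f h : G.Ell2} :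
    GeneratorMapsTo G.heatSemigroup f h ↔ G.LapTo f h := by
  refine (G.isHeatSemigroup_heatSemigroup.generator f h).trans
    ⟨fun ⟨h1, h2⟩ => ⟨h1.1, h2⟩, fun ⟨h1, h2⟩ => ⟨⟨h1, ?_⟩, h2⟩⟩
  rw [show G.laplacian f = (h : V → ℝ) from funext h2]
  exact h.mem

theorem memDQ_of_finite {f : V → ℝ} (hf : (Function.support f).Finite) : G.MemDQ f := by
  refine ⟨fun _ => f, fun _ => hf, ?_⟩
  simp [formNormSq, energy]

/-- A finitely supported function as an element of `ℓ²(V, m)`. -/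
def ofFinite (f : V → ℝ) (hf : (Function.support f).Finite) : G.Ell2 :=
  ⟨f, G.memEll2_of_finite hf⟩

theorem lapTo_ofFinite {f : V → ℝ} (hf : (Function.support f).Finite) :
    G.LapTo (G.ofFinite f hf) (G.ofFinite _ (G.finite_support_laplacian hf)) :=
  ⟨G.memDQ_of_finite hf, fun _ => rfl⟩

variable {G}

theorem LapTo.heat {f h : G.Ell2} (hf : G.LapTo f h) {t : ℝ} (ht : 0 ≤ t) :
    G.LapTo (G.heatSemigroup t f) (G.heatSemigroup t h) :=
  G.generatorMapsTo_iff.1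
    (G.isC0Semigroup_heatSemigroup.generator_apply (G.generatorMapsTo_iff.2 hf) ht)

theorem LapTo.hasDerivAt {f h : G.Ell2} (hf : G.LapTo f h) {t : ℝ} (ht : 0 < t) :
    HasDerivAt (fun s => G.heatSemigroup s f) (G.heatSemigroup t h) t :=
  G.isC0Semigroup_heatSemigroup.hasDerivAt (G.generatorMapsTo_iff.2 hf) ht

/-- Membership in the domain becomes an equation for the bounded operator (1 - Δ)⁻¹. Linearity and
symmetry on the domain are then read off from the resolvent. -/
theorem LapTo.resolvent_sub {f h : G.Ell2} (hf : G.LapTo f h) : G.resolvent (f - h) = f := by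
  refine (G.resolvent_eq_iff f (f - h)).2 ⟨hf.1, fun x => ?_⟩
  rw [hf.2, Ell2.sub_apply]

theorem LapTo.sub {f h a b : G.Ell2} (hf : G.LapTo f h) (ha : G.LapTo a b) :
    G.LapTo (f - a) (h - b) := by
  have hr : G.resolvent (f - a - (h - b)) = f - a := by
    rw [show f - a - (h - b) = (f - h) - (a - b) by abel, map_sub, hf.resolvent_sub,
      ha.resolvent_sub]
  obtain ⟨h1, h2⟩ := (G.resolvent_eq_iff _ _).1 hr
  refine ⟨h1, fun x => ?_⟩
  have := h2 x
  rw [Ell2.sub_apply (f - a)] at this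
  linarith

variable (G)

theorem inner_resolvent_comm (u v : G.Ell2) :
    inner ℝ (G.resolvent u) v = inner ℝ u (G.resolvent v) := by
  simp only [resolvent, ContinuousLinearMap.comp_apply]
  rw [← ContinuousLinearMap.adjoint_inner_right, ContinuousLinearMap.adjoint_inner_left]

variable {G}

/-- The Laplacian is symmetric on its domain. -/
theorem LapTo.inner_comm {f h a b : G.Ell2} (hf : G.LapTo f h) (ha : G.LapTo a b) :
    inner ℝ h a = inner ℝ f b := by
  have h1 : inner ℝ (f - h) a = inner ℝ f (a - b) := by
    conv_lhs => rw [← ha.resolvent_sub]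
    rw [← inner_resolvent_comm, hf.resolvent_sub]
  rw [inner_sub_left, inner_sub_right] at h1
  linarith

/-- The heat semigroup is symmetric on the domain of the Laplacian. -/
theorem LapTo.inner_heat_comm {f h a b : G.Ell2} (hf : G.LapTo f h) (ha : G.LapTo a b) {t : ℝ}
    (ht : 0 ≤ t) :
    inner ℝ (G.heatSemigroup t f) a = inner ℝ f (G.heatSemigroup t a) := by
  have hP := G.isC0Semigroup_heatSemigroup
  have hcont : ContinuousOn
      (fun s => inner ℝ (G.heatSemigroup s f) (G.heatSemigroup (t - s) a)) (Set.Icc 0 t) := by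
    refine ((hP.continuousOn f).mono Set.Icc_subset_Ici_self).inner ?_
    exact (hP.continuousOn a).comp (by fun_prop) fun s hs => Set.mem_Ici.2 (sub_nonneg.2 hs.2)
  have hd : ∀ s ∈ Set.Ioo 0 t, HasDerivAt
      (fun s => inner ℝ (G.heatSemigroup s f) (G.heatSemigroup (t - s) a)) 0 s := by
    intro s hs
    have h1 := hf.hasDerivAt hs.1
    have h2 := (ha.hasDerivAt (sub_pos.2 hs.2)).scomp s ((hasDerivAt_id s).const_sub t)
    refine (h1.inner ℝ h2).congr_deriv ?_
    simp only [Function.comp_apply, neg_smul, one_smul, inner_neg_right]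
    rw [(hf.heat hs.1.le).inner_comm (ha.heat (sub_pos.2 hs.2).le)]
    ring
  -- The pairing ⟨P_s f, P_{t-s} a⟩ has zero derivative inside the interval, so it is both monotone
  -- and antitone; its two endpoint values are the two sides.
  have hm := monotoneOn_of_deriv_nonneg (convex_Icc 0 t) hcont
    (fun s hs => (hd s (by rwa [interior_Icc] at hs)).differentiableAt.differentiableWithinAt)
    (fun s hs => (hd s (by rwa [interior_Icc] at hs)).deriv.ge)
  have ha := antitoneOn_of_deriv_nonpos (convex_Icc 0 t) hcont
    (fun s hs => (hd s (by rwa [interior_Icc] at hs)).differentiableAt.differentiableWithinAt)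
    (fun s hs => (hd s (by rwa [interior_Icc] at hs)).deriv.le)
  have h0 : (0 : ℝ) ∈ Set.Icc 0 t := ⟨le_rfl, ht⟩
  have h1 : t ∈ Set.Icc 0 t := ⟨ht, le_rfl⟩
  have := le_antisymm (ha h0 h1 ht) (hm h0 h1 ht)
  simpa [hP.zero_apply] using this

variable (G)

/-- Dominated convergence with majorant C |m a b|; it removes η_k or η_k² from pairings of two ℓ²
functions. -/
theorem tendsto_tsum_cutoff {a b : V → ℝ} (ha : G.MemEll2 a) (hb : G.MemEll2 b) {θ : ℕ → V → ℝ}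
    {C c : ℝ} (hC : ∀ k x, |θ k x| ≤ C) (hlim : ∀ x, Tendsto (fun k => θ k x) atTop (𝓝 c)) :
    Tendsto (fun k => ∑' x, G.m x * (θ k x * (a x * b x))) atTop
      (𝓝 (c * ∑' x, G.m x * (a x * b x))) := by
  have hs := (G.memEll2_mul ha hb).abs.mul_left C
  rw [← tsum_mul_left]
  refine tendsto_tsum_of_dominated_convergence hs (fun x => ?_) (Eventually.of_forall fun k x => ?_)
  · have := ((hlim x).mul_const (a x * b x)).const_mul (G.m x)
    rwa [mul_left_comm] at this
  · rw [mul_left_comm, Real.norm_eq_abs, abs_mul]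
    exact mul_le_mul_of_nonneg_right (hC k x) (abs_nonneg _)

/-- The negative part of an element of `ℓ²(V, m)`. -/
def negPart (f : G.Ell2) : G.Ell2 :=
  ⟨fun x => max (-f x) 0, f.mem.of_nonneg_of_le
    (fun x => mul_nonneg (G.m_pos x).le (sq_nonneg _)) fun x => by
      refine mul_le_mul_of_nonneg_left ?_ (G.m_pos x).le
      change max (-f x) 0 ^ 2 ≤ f x ^ 2
      rcases le_total (-f x) 0 with h | h
      · rw [max_eq_right h]; nlinarith [sq_nonneg (f x)]
      · rw [max_eq_left h]; nlinarith⟩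

theorem negPart_apply (f : G.Ell2) (x : V) : G.negPart f x = max (-f x) 0 := rfl

variable {G}

/-- For v the negative part of u, one has vΔu ≥ -vΔv pointwise. Testing with η_k², the Caccioppoli
inequality and the dissipativity of Δ on the finitely supported η_k v leave only an error
‖v‖²/(k+1). -/
theorem LapTo.inner_negPart_nonneg (hG : G.IsComplete) {u h : G.Ell2} (hu : G.LapTo u h) :
    0 ≤ inner ℝ (G.negPart u) h := by
  obtain ⟨η, B, hfin, hB, hlim, hΓ⟩ := hG.exists_cutoff
  set v := G.negPart u with hv
  have hv0 : ∀ x, 0 ≤ v x := fun x => le_max_right _ _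
  have hvu : ∀ x, -u x ≤ v x := fun x => le_max_left _ _
  -- Where v is positive it equals -u, while v ≥ -u at every neighbour; hence Δv ≥ -Δu at such a
  -- vertex.
  have hlap : ∀ x, 0 ≤ v x * (h x + G.laplacian v x) := by
    intro x
    rcases (hv0 x).eq_or_lt with h0 | h0
    · rw [← h0, zero_mul]
    · have hx : v x = -u x := by
        rw [hv, negPart_apply] at h0 ⊢
        rcases max_cases (-u x) 0 with h1 | h1
        · exact h1.1
        · rw [h1.1] at h0; exact absurd h0 (lt_irrefl _)
      refine mul_nonneg (hv0 x) ?_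
      rw [← hu.2]
      refine nonneg_of_mul_nonneg_right (a := G.m x) ?_ (G.m_pos x)
      rw [mul_add, m_mul_laplacian, m_mul_laplacian, ← Finset.sum_add_distrib]
      refine Finset.sum_nonneg fun y _ => ?_
      rw [← mul_add]
      exact mul_nonneg (G.μ_nonneg x y) (by linarith [hvu y])
  have hcut : Tendsto (fun k => ∑' x, G.m x * (η k x ^ 2 * (v x * h x))) atTop
      (𝓝 (1 * ∑' x, G.m x * (v x * h x))) :=
    G.tendsto_tsum_cutoff v.mem h.mem (C := B ^ 2)
      (fun k x => by rw [abs_pow]; exact pow_le_pow_left₀ (abs_nonneg _) (hB k x) 2)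
      (fun x => by simpa using (hlim x).pow 2)
  rw [one_mul] at hcut
  have hz : Tendsto (fun k : ℕ => -(1 / ((k : ℝ) + 1) * ∑' x, G.m x * v x ^ 2)) atTop (𝓝 0) := by
    simpa using (tendsto_one_div_add_atTop_nhds_zero_nat (𝕜 := ℝ)).mul_const
      (∑' x, G.m x * v x ^ 2) |>.neg
  refine le_of_tendsto_of_tendsto hz hcut (Eventually.of_forall fun k => ?_)
  have hc := G.caccioppoli (hfin k) (by positivity) (hΓ k) v.mem
  have hn := G.tsum_mul_laplacian_self_nonpos (a := η k * v) ((hfin k).subset fun x hx => by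
    simp only [Function.mem_support, Pi.mul_apply] at hx ⊢
    exact left_ne_zero_of_mul hx)
  simp only [Pi.mul_apply] at hn
  have hsum : ∀ F : V → ℝ, Summable fun x => G.m x * (η k x ^ 2 * F x) := fun F =>
    summable_of_hasFiniteSupport ((hfin k).subset fun x hx hx0 => hx (by simp [hx0]))
  have h3 : - ∑' x, G.m x * ((η k x ^ 2 * v x) * G.laplacian v x) ≤
      ∑' x, G.m x * (η k x ^ 2 * (v x * h x)) := by
    rw [← tsum_neg]
    refine Summable.tsum_le_tsum (fun x => ?_)
      ((hsum fun x => v x * G.laplacian v x).neg.congr fun x => by ring) (hsum _)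
    have := mul_nonneg (G.m_pos x).le (mul_nonneg (sq_nonneg (η k x)) (hlap x))
    linarith
  linarith

/-- The scalar function r ↦ max(-r, 0)² has derivative -2 max(-r, 0), which is 2-Lipschitz. Its
first-order Taylor remainder is therefore at most the square of the increment, and this is summed
over the vertices. -/
theorem norm_negPart_sq_sub (a b : G.Ell2) :
    |‖G.negPart b‖ ^ 2 - ‖G.negPart a‖ ^ 2 + 2 * inner ℝ (G.negPart a) (b - a)| ≤ ‖b - a‖ ^ 2 := by
  have s1 := (G.negPart b).mem
  have s2 := (G.negPart a).mem
  have s3 := (G.memEll2_mul (G.negPart a).mem (b - a).mem).mul_left 2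
  rw [Ell2.norm_sq, Ell2.norm_sq, Ell2.norm_sq, Ell2.inner_def, ← tsum_mul_left,
    ← Summable.tsum_sub s1 s2, ← Summable.tsum_add (s1.sub s2) s3, ← Real.norm_eq_abs]
  refine tsum_of_norm_bounded (b - a).mem.hasSum fun x => ?_
  rw [Ell2.sub_apply, negPart_apply, negPart_apply, Real.norm_eq_abs, ← mul_sub,
    mul_left_comm 2 (G.m x), ← mul_add, abs_mul, abs_of_pos (G.m_pos x)]
  refine mul_le_mul_of_nonneg_left ?_ (G.m_pos x).le
  rw [abs_le]
  rcases max_cases (-a x) 0 with h1 | h1 <;> rcases max_cases (-b x) 0 with h2 | h2 <;>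
    rw [h1.1, h2.1] <;> constructor <;> nlinarith

/-- The remainder in `norm_negPart_sq_sub` is quadratic in u s - u t, which is O(s - t), so it does
not contribute to the derivative. The map f ↦ `negPart` f itself is never differentiated. -/
theorem hasDerivAt_norm_negPart_sq {u : ℝ → G.Ell2} {u' : G.Ell2} {t : ℝ}
    (hu : HasDerivAt u u' t) :
    HasDerivAt (fun s => ‖G.negPart (u s)‖ ^ 2) (-(2 * inner ℝ (G.negPart (u t)) u')) t := by
  have h1 : HasDerivAt (fun s => ‖G.negPart (u s)‖ ^ 2 - ‖G.negPart (u t)‖ ^ 2 +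
      2 * inner ℝ (G.negPart (u t)) (u s - u t)) 0 t := by
    rw [hasDerivAt_iff_isLittleO]
    simp only [sub_self, inner_zero_right, mul_zero, add_zero, sub_zero, smul_zero]
    have hO : (fun s => u s - u t) =O[𝓝 t] fun s => s - t := hu.isBigO_sub
    have ho : (fun s => u s - u t) =o[𝓝 t] fun _ => (1 : ℝ) := by
      rw [Asymptotics.isLittleO_one_iff]
      simpa using hu.continuousAt.tendsto.sub_const (u t)
    have hmul : (fun s => ‖u s - u t‖ * ‖u s - u t‖) =o[𝓝 t] fun s => (s - t) * 1 :=
      hO.norm_left.mul_isLittleO ho.norm_left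
    simp only [mul_one] at hmul
    refine Asymptotics.IsBigO.trans_isLittleO ?_ hmul
    refine Asymptotics.IsBigO.of_bound 1 (Eventually.of_forall fun s => ?_)
    rw [Real.norm_eq_abs, one_mul, Real.norm_eq_abs, abs_mul_self, ← sq]
    exact norm_negPart_sq_sub _ _
  have h2 : HasDerivAt (fun s => 2 * inner ℝ (G.negPart (u t)) (u s - u t))
      (2 * inner ℝ (G.negPart (u t)) u') t := by
    have := ((hasDerivAt_const t (G.negPart (u t))).inner ℝ (hu.sub_const (u t))).const_mul 2
    simpa using this
  have h3 := (h1.sub h2).add_const (‖G.negPart (u t)‖ ^ 2)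
  rw [zero_sub] at h3
  refine h3.congr_of_eventuallyEq (Eventually.of_forall fun s => ?_)
  simp only [Pi.sub_apply]
  ring

theorem continuous_norm_negPart_sq : Continuous fun f : G.Ell2 => ‖G.negPart f‖ ^ 2 := by
  rw [continuous_iff_continuousAt]
  intro a
  have h1 : Tendsto (fun b : G.Ell2 => ‖b - a‖ ^ 2) (𝓝 a) (𝓝 0) := by
    have : Continuous fun b : G.Ell2 => ‖b - a‖ ^ 2 := by fun_prop
    simpa using this.tendsto a
  have h2 : Tendsto (fun b : G.Ell2 => 2 * inner ℝ (G.negPart a) (b - a)) (𝓝 a) (𝓝 0) := by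
    have : Continuous fun b : G.Ell2 => 2 * inner ℝ (G.negPart a) (b - a) := by fun_prop
    simpa using this.tendsto a
  have h3 : Tendsto (fun b => ‖G.negPart b‖ ^ 2 - ‖G.negPart a‖ ^ 2 +
      2 * inner ℝ (G.negPart a) (b - a)) (𝓝 a) (𝓝 0) :=
    squeeze_zero_norm (fun b => norm_negPart_sq_sub (G := G) a b) h1
  have h4 := (h3.sub h2).add_const (‖G.negPart a‖ ^ 2)
  simp only [sub_zero, zero_add] at h4
  refine h4.congr fun b => ?_
  ring

/-- The heat semigroup preserves positivity. -/
theorem LapTo.heat_nonneg (hG : G.IsComplete) {f h : G.Ell2} (hf : G.LapTo f h)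
    (h0 : ∀ x, 0 ≤ f x) {t : ℝ} (ht : 0 ≤ t) (x : V) : 0 ≤ G.heatSemigroup t f x := by
  have hP := G.isC0Semigroup_heatSemigroup
  have hd : ∀ s ∈ interior (Set.Ici (0 : ℝ)), HasDerivAt
      (fun s => ‖G.negPart (G.heatSemigroup s f)‖ ^ 2)
      (-(2 * inner ℝ (G.negPart (G.heatSemigroup s f)) (G.heatSemigroup s h))) s := by
    intro s hs
    rw [interior_Ici] at hs
    exact hasDerivAt_norm_negPart_sq (hf.hasDerivAt hs)
  have hanti := antitoneOn_of_deriv_nonpos (convex_Ici (0 : ℝ))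
    (continuous_norm_negPart_sq.comp_continuousOn (hP.continuousOn f))
    (fun s hs => (hd s hs).differentiableAt.differentiableWithinAt)
    (fun s hs => by
      refine (hd s hs).deriv.trans_le ?_
      rw [interior_Ici] at hs
      linarith [(hf.heat (le_of_lt hs)).inner_negPart_nonneg hG])
  have h1 := hanti (Set.mem_Ici.2 le_rfl) (Set.mem_Ici.2 ht) ht
  have h2 : G.negPart f = 0 := Ell2.ext fun x => by
    rw [negPart_apply, max_eq_right (by linarith [h0 x])]; rfl
  simp only [Function.comp_apply, hP.zero_apply, h2, norm_zero] at h1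
  have h3 : G.negPart (G.heatSemigroup t f) = 0 := by
    rw [← norm_eq_zero]
    nlinarith [norm_nonneg (G.negPart (G.heatSemigroup t f))]
  have h4 : max (-G.heatSemigroup t f x) 0 = 0 := by
    rw [← negPart_apply, h3]; rfl
  linarith [le_max_left (-G.heatSemigroup t f x) 0]

end WeightedGraph

/-! ### Green's formulas and integration by parts against subsolutions. -/

namespace WeightedGraph

variable {V : Type u} (G : WeightedGraph V)

/-- The weights √(μ/2) in `embed` are chosen so that the row of x in the edge component carries Γ at
x. Bounds on Γ thereby become ℓ² bounds on rows. -/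
theorem hasSum_embed_inr_mul (f g : V → ℝ) (x : V) :
    HasSum (fun y => G.embed f (Sum.inr (x, y)) * G.embed g (Sum.inr (x, y)))
      (G.m x * G.gamma f g x) := by
  rw [m_mul_gamma]
  have h : ∀ y, G.embed f (Sum.inr (x, y)) * G.embed g (Sum.inr (x, y)) =
      G.μ x y / 2 * ((f y - f x) * (g y - g x)) := by
    intro y
    have hs := Real.mul_self_sqrt (div_nonneg (G.μ_nonneg x y) zero_le_two)
    simp only [embed, Sum.elim_inr]
    linear_combination ((f y - f x) * (g y - g x)) * hs
  simp only [h]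
  refine hasSum_sum_of_ne_finset_zero fun y hy => ?_
  rw [G.μ_eq_zero x y (fun h => hy (G.mem_nbrs.2 h))]
  ring

theorem finite_support_mul_left {a : V → ℝ} (ha : (Function.support a).Finite) (b : V → ℝ) :
    (Function.support (a * b)).Finite :=
  ha.subset fun x hx h => hx (by simp [h])

theorem summable_of_finite_support {a : V → ℝ} (ha : (Function.support a).Finite) (b : V → ℝ) :
    Summable fun x => G.m x * (a x * b x) :=
  summable_of_hasFiniteSupport (ha.subset fun x hx h => hx (by simp [h]))

/-- The image in the Hilbert space of pairs of a finitely supported function. -/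
noncomputable def embedFinite (a : V → ℝ) (ha : (Function.support a).Finite) :
    lp (fun _ : V ⊕ V × V => ℝ) 2 := ⟨G.embed a, G.embed_memℓp ha⟩

theorem embedFinite_eq_sum {a : V → ℝ} (ha : (Function.support a).Finite) :
    G.embedFinite a ha = ∑ x ∈ ha.toFinset, a x • G.pt x := by
  classical
  have hfs : a = ∑ x ∈ ha.toFinset, a x • (Pi.single x 1 : V → ℝ) := by
    funext y
    rw [Finset.sum_apply]
    by_cases hy : a y = 0
    · rw [hy, Finset.sum_eq_zero]
      intro x hx
      have : y ≠ x := by rintro rfl; simp [hy] at hx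
      simp [Pi.single_eq_of_ne this]
    · rw [Finset.sum_eq_single y]
      · simp
      · intro x _ hx
        simp [Pi.single_eq_of_ne hx.symm]
      · intro h; simp [hy] at h
  let L : (V → ℝ) →ₗ[ℝ] (V ⊕ V × V → ℝ) :=
    { toFun := G.embed, map_add' := G.embed_add, map_smul' := G.embed_smul }
  refine lp.ext ?_
  rw [lp.coeFn_sum]
  change L a = _
  conv_lhs => rw [hfs]
  rw [map_sum]
  refine Finset.sum_congr rfl fun x _ => ?_
  rw [map_smul, lp.coeFn_smul]
  congr 1

/-- Green's formula against a finitely supported function. -/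
theorem inner_embedFinite {w : lp (fun _ : V ⊕ V × V => ℝ) 2} {f : V → ℝ}
    (hw : (w : V ⊕ V × V → ℝ) = G.embed f) {a : V → ℝ} (ha : (Function.support a).Finite) :
    inner ℝ w (G.embedFinite a ha) = ∑' x, G.m x * (a x * (f x - G.laplacian f x)) := by
  rw [embedFinite_eq_sum, inner_sum, tsum_eq_sum (s := ha.toFinset)]
  · refine Finset.sum_congr rfl fun x _ => ?_
    rw [real_inner_smul_right, G.inner_pt hw]
    ring
  · intro x hx
    have : a x = 0 := by simpa using hx
    simp [this]

/-- Separates the diagonal (degree) part of Δ from the off-diagonal part. Only neighbours where a is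
nonzero need lie in S, so the formula serves both a function supported in S and an arbitrary
function at a vertex whose neighbours lie in S. -/
theorem m_mul_laplacian_eq_sub {S : Finset V} {a : V → ℝ} {x : V}
    (h : ∀ y ∈ G.nbrs x, a y ≠ 0 → y ∈ S) :
    G.m x * G.laplacian a x = ∑ y ∈ S, G.μ x y * a y - a x * ∑ y ∈ G.nbrs x, G.μ x y := by
  classical
  have h1 : ∑ y ∈ S, G.μ x y * a y = ∑ y ∈ G.nbrs x, G.μ x y * a y := by
    have h2 : ∀ y ∉ S ∩ G.nbrs x, (y ∈ S ∨ y ∈ G.nbrs x) → G.μ x y * a y = 0 := by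
      intro y hy _
      by_cases hn : y ∈ G.nbrs x
      · have : a y = 0 := by
          by_contra h0
          exact hy (Finset.mem_inter.2 ⟨h y hn h0, hn⟩)
        rw [this, mul_zero]
      · rw [G.μ_eq_zero x y (fun h => hn (G.mem_nbrs.2 h)), zero_mul]
    rw [← Finset.sum_subset Finset.inter_subset_left fun y hy hn => h2 y hn (Or.inl hy),
      ← Finset.sum_subset Finset.inter_subset_right fun y hy hn => h2 y hn (Or.inr hy)]
  rw [m_mul_laplacian, h1, Finset.mul_sum, ← Finset.sum_sub_distrib]
  exact Finset.sum_congr rfl fun y _ => by ring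

/-- Symmetry of the Laplacian when one of the functions has finite support. -/
theorem tsum_laplacian_comm {a : V → ℝ} (ha : (Function.support a).Finite) (b : V → ℝ) :
    ∑' x, G.m x * (b x * G.laplacian a x) = ∑' x, G.m x * (a x * G.laplacian b x) := by
  obtain ⟨S, hS⟩ := G.exists_finset_nbhd ha
  have hlap : ∀ x ∉ S, G.laplacian a x = 0 := by
    intro x hx
    rw [laplacian, Finset.sum_eq_zero, mul_zero]
    intro y hy
    have hx0 : a x = 0 := by
      by_contra h
      exact hx (hS x h).1
    have hy0 : a y = 0 := by
      by_contra h
      exact hx ((hS y h).2 (G.mem_nbrs_comm.1 hy))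
    rw [hx0, hy0]; ring
  rw [tsum_eq_sum (s := S) (fun x hx => by rw [hlap x hx]; ring),
    tsum_eq_sum (s := S) (fun x hx => by
      have : a x = 0 := by
        by_contra h
        exact hx (hS x h).1
      rw [this]; ring)]
  -- After the split, the degree terms of the two sides coincide and the off-diagonal double sums
  -- are transposes of each other.
  have e1 : ∀ x ∈ S, G.m x * (b x * G.laplacian a x) =
      ∑ y ∈ S, G.μ x y * (b x * a y) - a x * b x * ∑ y ∈ G.nbrs x, G.μ x y := by
    intro x _
    rw [mul_left_comm, G.m_mul_laplacian_eq_sub fun y _ h => (hS y h).1, mul_sub, Finset.mul_sum]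
    congr 1
    · exact Finset.sum_congr rfl fun y _ => by ring
    · ring
  have e2 : ∀ x ∈ S, G.m x * (a x * G.laplacian b x) =
      ∑ y ∈ S, G.μ x y * (a x * b y) - a x * b x * ∑ y ∈ G.nbrs x, G.μ x y := by
    intro x _
    by_cases hx : a x = 0
    · simp [hx]
    · rw [mul_left_comm, G.m_mul_laplacian_eq_sub fun y hy _ => (hS x hx).2 hy, mul_sub,
        Finset.mul_sum]
      congr 1
      · exact Finset.sum_congr rfl fun y _ => by ring
      · ring
  rw [Finset.sum_congr rfl e1, Finset.sum_congr rfl e2, Finset.sum_sub_distrib,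
    Finset.sum_sub_distrib, Finset.sum_comm]
  congr 1
  refine Finset.sum_congr rfl fun x _ => Finset.sum_congr rfl fun y _ => ?_
  rw [G.μ_symm y x]; ring

/-- The difference of squares factors, and |η y + η x| ≤ 2B. -/
theorem gamma_sq_le {η : V → ℝ} {B : ℝ} (hB : ∀ x, |η x| ≤ B) (x : V) :
    G.gamma (η ^ 2) (η ^ 2) x ≤ 4 * B ^ 2 * G.gamma η η x := by
  refine le_of_mul_le_mul_left ?_ (G.m_pos x)
  rw [mul_left_comm, m_mul_gamma, m_mul_gamma, Finset.mul_sum]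
  refine Finset.sum_le_sum fun y _ => ?_
  rw [mul_left_comm (4 * B ^ 2)]
  refine mul_le_mul_of_nonneg_left ?_ (div_nonneg (G.μ_nonneg x y) zero_le_two)
  have h1 : (η y + η x) ^ 2 ≤ (2 * B) ^ 2 := by
    rw [sq_le_sq]
    refine (abs_add_le _ _).trans ?_
    have : 0 ≤ B := (abs_nonneg _).trans (hB x)
    rw [abs_of_nonneg (by positivity : 0 ≤ 2 * B)]
    linarith [hB x, hB y]
  simp only [Pi.pow_apply]
  nlinarith [mul_le_mul_of_nonneg_right h1 (sq_nonneg (η y - η x))]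

/-- Multiplication by `1 - η_k²`, for cutoff functions `η_k`, tends to zero in the form norm. -/
theorem tendsto_norm_cutoff {η : ℕ → V → ℝ} {B : ℝ} (hB : ∀ k x, |η k x| ≤ B)
    (hlim : ∀ x, Tendsto (fun k => η k x) atTop (𝓝 1))
    (hΓ : ∀ k x, G.gamma (η k) (η k) x ≤ 1 / ((k : ℝ) + 1)) {h : V → ℝ} (hh : G.MemEll2 h)
    {H : lp (fun _ : V ⊕ V × V => ℝ) 2} (hH : (H : V ⊕ V × V → ℝ) = G.embed h)
    {Z : ℕ → lp (fun _ : V ⊕ V × V => ℝ) 2}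
    (hZ : ∀ k, (Z k : V ⊕ V × V → ℝ) = G.embed (h - η k ^ 2 * h)) :
    Tendsto (fun k => ‖Z k‖) atTop (𝓝 0) := by
  have hB2 : ∀ k x, |1 - η k x ^ 2| ≤ 1 + B ^ 2 := fun k x => by
    have h1 : η k x ^ 2 ≤ B ^ 2 := sq_le_sq.2 ((hB k x).trans (le_abs_self B))
    rw [abs_le]; constructor <;> nlinarith [sq_nonneg (η k x)]
  -- Product rule for z = (1 - η²)h: the increment z y - z x equals (1 - η(y)²)(h y - h x) -
  -- h(x)(η(y)² - η(x)²). The factor in the first term is c; it is bounded and tends to zero, so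
  -- dominated convergence applies.
  let c : ℕ → V ⊕ V × V → ℝ := fun k =>
    Sum.elim (fun x => 1 - η k x ^ 2) (fun p => 1 - η k p.2 ^ 2)
  have hc : ∀ k i, |c k i| ≤ 1 + B ^ 2 := by
    rintro k (x | p)
    · exact hB2 k x
    · exact hB2 k p.2
  have hc0 : ∀ i, Tendsto (fun k => c k i) atTop (𝓝 0) := by
    have : ∀ x, Tendsto (fun k => 1 - η k x ^ 2) atTop (𝓝 0) := fun x => by
      simpa using ((hlim x).pow 2).const_sub 1
    rintro (x | p)
    · exact this x
    · exact this p.2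
  have hbd : ∀ k i, (c k i * H i) ^ 2 ≤ (1 + B ^ 2) ^ 2 * H i ^ 2 := fun k i => by
    rw [mul_pow, ← sq_abs (c k i)]
    exact mul_le_mul_of_nonneg_right (pow_le_pow_left₀ (abs_nonneg _) (hc k i) 2) (sq_nonneg _)
  have hsH := (summable_sq_lp H).mul_left ((1 + B ^ 2) ^ 2)
  have hA : Tendsto (fun k => ∑' i, (c k i * H i) ^ 2) atTop (𝓝 0) := by
    have := tendsto_tsum_of_dominated_convergence (𝓕 := atTop)
      (f := fun k i => (c k i * H i) ^ 2) (g := fun _ => 0) hsH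
      (fun i => by simpa using ((hc0 i).mul_const (H i)).pow 2)
      (Eventually.of_forall fun k i => by
        rw [Real.norm_eq_abs, abs_of_nonneg (sq_nonneg _)]; exact hbd k i)
    simpa using this
  have hAs : ∀ k, Summable fun i => (c k i * H i) ^ 2 := fun k =>
    Summable.of_nonneg_of_le (fun _ => sq_nonneg _) (hbd k) hsH
  -- The second term of the product rule, where the cutoff is differentiated. Its squared norm is
  -- the sum of m h² Γ(η_k²), at most 4B²/(k+1) times ‖h‖².
  let b : ℕ → V ⊕ V × V → ℝ := fun k =>
    Sum.elim (fun _ => 0) (fun p => h p.1 * G.embed (η k ^ 2) (Sum.inr p))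
  have hbrow : ∀ k x, HasSum (fun y => b k (Sum.inr (x, y)) ^ 2)
      (h x ^ 2 * (G.m x * G.gamma (η k ^ 2) (η k ^ 2) x)) := fun k x => by
    refine ((G.hasSum_embed_inr_mul (η k ^ 2) (η k ^ 2) x).mul_left (h x ^ 2)).congr_fun
      fun y => ?_
    simp only [b, Sum.elim_inr]
    ring
  have hrowle : ∀ k x, h x ^ 2 * (G.m x * G.gamma (η k ^ 2) (η k ^ 2) x) ≤
      4 * B ^ 2 * (1 / ((k : ℝ) + 1)) * (G.m x * h x ^ 2) := fun k x => by
    have h1 := G.gamma_sq_le (hB k) x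
    have h2 := mul_le_mul_of_nonneg_left (hΓ k x) (by positivity : 0 ≤ 4 * B ^ 2)
    have h3 : 0 ≤ G.m x * h x ^ 2 := mul_nonneg (G.m_pos x).le (sq_nonneg _)
    nlinarith [mul_le_mul_of_nonneg_right (h1.trans h2) h3]
  have hrows : ∀ k, Summable fun x => h x ^ 2 * (G.m x * G.gamma (η k ^ 2) (η k ^ 2) x) :=
    fun k => Summable.of_nonneg_of_le (fun x => mul_nonneg (sq_nonneg _)
      (mul_nonneg (G.m_pos x).le (G.gamma_self_nonneg _ x))) (hrowle k)
      (Summable.mul_left _ hh)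
  have hbs : ∀ k, Summable fun p : V × V => b k (Sum.inr p) ^ 2 := fun k => by
    rw [summable_prod_of_nonneg fun p => sq_nonneg _]
    refine ⟨fun x => (hbrow k x).summable, (hrows k).congr fun x => ((hbrow k x).tsum_eq).symm⟩
  have hbsum : ∀ k, ∃ s, HasSum (fun i => b k i ^ 2) s ∧
      s ≤ 4 * B ^ 2 * (1 / ((k : ℝ) + 1)) * ∑' x, G.m x * h x ^ 2 := fun k => by
    refine ⟨0 + ∑' p : V × V, b k (Sum.inr p) ^ 2, ?_, ?_⟩
    · refine HasSum.sum (f := fun i => b k i ^ 2) ?_ (hbs k).hasSum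
      have h0 : (fun i => b k i ^ 2) ∘ Sum.inl = fun _ : V => (0 : ℝ) := by
        funext x
        simp [b]
      rw [h0]
      exact hasSum_zero
    · rw [zero_add, (hbs k).tsum_prod' fun x => (hbrow k x).summable, ← tsum_mul_left]
      simp only [(hbrow k _).tsum_eq]
      exact (hrows k).tsum_le_tsum (hrowle k) (Summable.mul_left _ hh)
  choose s hs hsle using hbsum
  have hs0 : Tendsto s atTop (𝓝 0) := by
    have h1 := ((tendsto_one_div_add_atTop_nhds_zero_nat (𝕜 := ℝ)).const_mul (4 * B ^ 2)).mul_const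
      (∑' x, G.m x * h x ^ 2)
    rw [mul_zero, zero_mul] at h1
    exact squeeze_zero (fun k => (hs k).nonneg fun i => sq_nonneg _) hsle h1
  have hZle : ∀ k, ‖Z k‖ ^ 2 ≤ 2 * (∑' i, (c k i * H i) ^ 2) + 2 * s k := fun k => by
    rw [norm_sq_lp, ← (hs k).tsum_eq, ← tsum_mul_left, ← tsum_mul_left,
      ← Summable.tsum_add ((hAs k).mul_left 2) ((hs k).summable.mul_left 2)]
    refine (summable_sq_lp _).tsum_le_tsum (fun i => ?_)
      (((hAs k).mul_left 2).add ((hs k).summable.mul_left 2))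
    have e : Z k i = c k i * H i - b k i := by
      rw [hZ, hH]
      rcases i with x | p
      · simp only [embed, Sum.elim_inl, c, b, Pi.sub_apply, Pi.mul_apply, Pi.pow_apply]; ring
      · simp only [embed, Sum.elim_inr, c, b, Pi.sub_apply, Pi.mul_apply, Pi.pow_apply]; ring
    rw [e]
    nlinarith [sq_nonneg (c k i * H i + b k i)]
  have hsq : Tendsto (fun k => ‖Z k‖ ^ 2) atTop (𝓝 0) := by
    refine squeeze_zero (fun k => sq_nonneg _) hZle ?_
    simpa using (hA.const_mul 2).add (hs0.const_mul 2)
  have := hsq.sqrt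
  simpa [Real.sqrt_sq] using this

variable {G}

/-- The cutoffs of a subsolution are bounded in the form norm. -/
theorem norm_embedFinite_cutoff_le {η : V → ℝ} {B : ℝ} (hη : (Function.support η).Finite)
    (hB : ∀ x, |η x| ≤ B) (hΓ : ∀ x, G.gamma η η x ≤ 1) (g F : G.Ell2)
    (hgF : ∀ x, g x * F x ≤ g x * G.laplacian g x) :
    ‖G.embedFinite (η * g) (finite_support_mul_left hη g)‖ ^ 2 ≤
      (B ^ 2 + 1) * ∑' x, G.m x * g x ^ 2 + B ^ 2 * ∑' x, |G.m x * (g x * F x)| := by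
  have hfin := finite_support_mul_left hη (g : V → ℝ)
  have hB2 : ∀ x, η x ^ 2 ≤ B ^ 2 := fun x => sq_le_sq.2 ((hB x).trans (le_abs_self B))
  rw [← real_inner_self_eq_norm_sq, G.inner_embedFinite rfl]
  have h0 : ∑' x, G.m x * ((η * (g : V → ℝ)) x * ((η * (g : V → ℝ)) x -
      G.laplacian (η * g) x)) = ∑' x, G.m x * ((η * (g : V → ℝ)) x * (η * (g : V → ℝ)) x) -
      ∑' x, G.m x * ((η * (g : V → ℝ)) x * G.laplacian (η * g) x) := by
    rw [← Summable.tsum_sub (G.summable_of_finite_support hfin _)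
      (G.summable_of_finite_support hfin _)]
    exact tsum_congr fun x => by ring
  have h1 : ∑' x, G.m x * ((η * (g : V → ℝ)) x * (η * (g : V → ℝ)) x) ≤
      B ^ 2 * ∑' x, G.m x * g x ^ 2 := by
    rw [← tsum_mul_left]
    refine (G.summable_of_finite_support hfin _).tsum_le_tsum (fun x => ?_)
      (Summable.mul_left _ g.mem)
    have := mul_le_mul_of_nonneg_right (hB2 x) (mul_nonneg (G.m_pos x).le (sq_nonneg (g x)))
    simp only [Pi.mul_apply]
    linarith
  -- The squared form norm is ‖ηg‖² - ⟨ηg, Δ(ηg)⟩; this trades the second term for -⟨η²g, Δg⟩ +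
  -- ‖g‖².
  have h2 := G.caccioppoli hη zero_le_one hΓ g.mem
  -- Since Δg is not assumed square summable, gΔg has no integrable bound of its own; the hypothesis
  -- on gF replaces it by a summable function.
  have h3 : - ∑' x, G.m x * ((η x ^ 2 * g x) * G.laplacian g x) ≤
      B ^ 2 * ∑' x, |G.m x * (g x * F x)| := by
    rw [← tsum_mul_left, ← tsum_neg]
    refine Summable.tsum_le_tsum (fun x => ?_) ?_ ((G.memEll2_mul g.mem F.mem).abs.mul_left _)
    · have h4 := mul_le_mul_of_nonneg_left (hgF x)
        (mul_nonneg (G.m_pos x).le (sq_nonneg (η x)))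
      have h5 := mul_le_mul_of_nonneg_right (hB2 x) (abs_nonneg (G.m x * (g x * F x)))
      have h6 := mul_le_mul_of_nonneg_left (neg_abs_le (G.m x * (g x * F x))) (sq_nonneg (η x))
      linarith
    · exact (G.summable_of_finite_support (a := fun x => η x ^ 2 * g x)
        (hη.subset fun x hx h => hx (by simp [h])) _).neg
  rw [h0]
  simp only [Pi.mul_apply] at h1 h2 ⊢
  linarith

/-- Integration by parts of a nonnegative function in the domain of the Laplacian against a
subsolution. -/
theorem LapTo.inner_le_of_subsolution (hG : G.IsComplete) {h h' : G.Ell2} (hh : G.LapTo h h')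
    (h0 : ∀ x, 0 ≤ h x) {g F : G.Ell2} (hF : ∀ x, F x ≤ G.laplacian g x)
    (hgF : ∀ x, g x * F x ≤ g x * G.laplacian g x) : inner ℝ h F ≤ inner ℝ h' g := by
  obtain ⟨η, B, hfin, hB, hlim, hΓ⟩ := hG.exists_cutoff
  have hB2 : ∀ k x, |η k x ^ 2| ≤ B ^ 2 := fun k x => by
    rw [abs_pow]; exact pow_le_pow_left₀ (abs_nonneg _) (hB k x) 2
  have hlim2 : ∀ x, Tendsto (fun k => η k x ^ 2) atTop (𝓝 1) := fun x => by
    simpa using (hlim x).pow 2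
  obtain ⟨H, -, hH⟩ := G.exists_of_memDQ hh.1
  have hfin2 : ∀ n, (Function.support (η n ^ 2 * (h : V → ℝ))).Finite := fun n =>
    (hfin n).subset fun x hx hx0 => hx (by simp [hx0])
  set Z : ℕ → lp (fun _ : V ⊕ V × V => ℝ) 2 := fun n => H - G.embedFinite _ (hfin2 n)
  have hZ : ∀ n, (Z n : V ⊕ V × V → ℝ) = G.embed (h - η n ^ 2 * h) := fun n => by
    rw [embed_sub, ← hH]; rfl
  have hZ0 := G.tendsto_norm_cutoff hB hlim hΓ h.mem hH hZ
  set a : ℕ → G.Ell2 := fun n => G.ofFinite _ (hfin2 n)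
  set a' : ℕ → G.Ell2 := fun n => G.ofFinite _ (G.finite_support_laplacian (hfin2 n))
  set C := (B ^ 2 + 1) * ∑' x, G.m x * g x ^ 2 + B ^ 2 * ∑' x, |G.m x * (g x * F x)|
  -- The left side is |⟨g, (1 - Δ)(h - η_n² h)⟩|. With g replaced by η_k g, Green's formula makes it
  -- a form inner product with `Z n`, and Cauchy–Schwarz applies with a bound on η_k g that is
  -- uniform in k; then k → ∞.
  have hpair : ∀ n, |inner ℝ g ((h - h') - (a n - a' n))| ≤ ‖Z n‖ * √C := by
    intro n
    have hk : Tendsto (fun k => ∑' x, G.m x * (η k x * (g x * ((h - h') - (a n - a' n)) x))) atTop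
        (𝓝 (inner ℝ g ((h - h') - (a n - a' n)))) := by
      have := G.tendsto_tsum_cutoff g.mem ((h - h') - (a n - a' n)).mem hB hlim
      rwa [one_mul] at this
    refine le_of_tendsto hk.abs (Eventually.of_forall fun k => ?_)
    have e := G.inner_embedFinite (hZ n) (finite_support_mul_left (hfin k) (g : V → ℝ))
    have e2 : ∑' x, G.m x * (η k x * (g x * ((h - h') - (a n - a' n)) x)) =
        inner ℝ (Z n) (G.embedFinite _ (finite_support_mul_left (hfin k) (g : V → ℝ))) := by
      rw [e]
      refine tsum_congr fun x => ?_
      have e3 : ((h - h') - (a n - a' n)) x = (h x - h' x) -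
          ((η n ^ 2 * (h : V → ℝ)) x - G.laplacian (η n ^ 2 * (h : V → ℝ)) x) := rfl
      rw [e3, laplacian_sub, hh.2]
      simp only [Pi.mul_apply, Pi.sub_apply]
      ring
    rw [e2]
    refine (abs_real_inner_le_norm _ _).trans (mul_le_mul_of_nonneg_left ?_ (norm_nonneg _))
    refine Real.le_sqrt_of_sq_le (norm_embedFinite_cutoff_le (hfin k) (hB k) (fun x => ?_) g F hgF)
    refine (hΓ k x).trans ?_
    rw [div_le_one (by positivity)]
    linarith [k.cast_nonneg (α := ℝ)]
  have hz : Tendsto (fun n => inner ℝ g ((h - h') - (a n - a' n))) atTop (𝓝 0) := by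
    refine squeeze_zero_norm hpair ?_
    simpa using hZ0.mul_const √C
  have ha : Tendsto (fun n => inner ℝ g (a n)) atTop (𝓝 (inner ℝ g h)) := by
    have := G.tendsto_tsum_cutoff g.mem h.mem hB2 hlim2
    rw [one_mul] at this
    refine this.congr fun n => ?_
    rw [Ell2.inner_def]
    refine tsum_congr fun x => ?_
    change _ = G.m x * (g x * (η n x ^ 2 * h x))
    ring
  -- The pairings with (1 - Δ)(h - η_n² h) and with h - η_n² h both vanish in the limit, hence so
  -- does the pairing with Δ(h - η_n² h).
  have ha' : Tendsto (fun n => inner ℝ g (a' n)) atTop (𝓝 (inner ℝ g h')) := by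
    have h1 := (hz.add ha).sub_const (inner ℝ g h - inner ℝ g h')
    rw [zero_add, sub_sub_cancel] at h1
    refine h1.congr fun n => ?_
    simp only [inner_sub_right]
    ring
  have hF' : Tendsto (fun n => ∑' x, G.m x * (η n x ^ 2 * (h x * F x))) atTop
      (𝓝 (inner ℝ h F)) := by
    have := G.tendsto_tsum_cutoff h.mem F.mem hB2 hlim2
    rwa [one_mul] at this
  rw [real_inner_comm g h']
  refine le_of_tendsto_of_tendsto hF' ha' (Eventually.of_forall fun n => ?_)
  -- Because η_n² h has finite support, Δ passes onto g without any integrability; F ≤ Δg and h ≥ 0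
  -- then give the inequality for each n.
  have e : inner ℝ g (a' n) = ∑' x, G.m x * (η n x ^ 2 * (h x * G.laplacian g x)) := by
    rw [Ell2.inner_def]
    refine (G.tsum_laplacian_comm (hfin2 n) (g : V → ℝ)).trans (tsum_congr fun x => ?_)
    simp only [Pi.mul_apply, Pi.pow_apply]
    ring
  refine le_of_le_of_eq ?_ e.symm
  have hsum : ∀ F : V → ℝ, Summable fun x => G.m x * (η n x ^ 2 * F x) := fun F =>
    summable_of_hasFiniteSupport ((hfin n).subset fun x hx hx0 => hx (by simp [hx0]))
  refine (hsum _).tsum_le_tsum (fun x => ?_) (hsum _)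
  have := G.m_pos x
  have := h0 x
  gcongr
  exact hF x

end WeightedGraph

/-! ### Products and gradient forms as bounded bilinear maps on ℓ² and on the form space. -/

namespace WeightedGraph

variable {V : Type u} {G : WeightedGraph V}

/-- On a graph with nondegenerate measure, pointwise multiplication is a bounded bilinear map. -/
theorem Nondegenerate.exists_mul (hm : G.Nondegenerate) :
    ∃ M : G.Ell2 →L[ℝ] G.Ell2 →L[ℝ] G.Ell2, ∀ f g x, M f g x = f x * g x := by
  obtain ⟨δ, hδ, hδm⟩ := hm
  -- The embedding of ℓ² into ℓ^∞, where m ≥ δ is used.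
  have hpt : ∀ (f : G.Ell2) x, f x ^ 2 ≤ δ⁻¹ * ‖f‖ ^ 2 := fun f x => by
    rw [le_inv_mul_iff₀ hδ, Ell2.norm_sq]
    exact (mul_le_mul_of_nonneg_right (hδm x) (sq_nonneg _)).trans
      (f.mem.le_tsum x fun y _ => mul_nonneg (G.m_pos y).le (sq_nonneg _))
  have hle : ∀ (f g : G.Ell2) x, G.m x * (f x * g x) ^ 2 ≤
      δ⁻¹ * ‖f‖ ^ 2 * (G.m x * g x ^ 2) := fun f g x => by
    have := mul_le_mul_of_nonneg_right (hpt f x) (mul_nonneg (G.m_pos x).le (sq_nonneg (g x)))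
    linarith
  have hmem : ∀ f g : G.Ell2, G.MemEll2 fun x => f x * g x := fun f g =>
    Summable.of_nonneg_of_le (fun x => mul_nonneg (G.m_pos x).le (sq_nonneg _)) (hle f g)
      (Summable.mul_left _ g.mem)
  let B : G.Ell2 →ₗ[ℝ] G.Ell2 →ₗ[ℝ] G.Ell2 :=
    LinearMap.mk₂ ℝ (fun f g => (⟨fun x => f x * g x, hmem f g⟩ : G.ell2Submodule))
      (fun f f' g => Ell2.ext fun x => add_mul _ _ _)
      (fun c f g => Ell2.ext fun x => mul_assoc _ _ _)
      (fun f g g' => Ell2.ext fun x => mul_add _ _ _)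
      (fun c f g => Ell2.ext fun x => mul_left_comm _ _ _)
  have hB : ∀ f g x, B f g x = f x * g x := fun f g x => rfl
  refine ⟨B.mkContinuous₂ √(δ⁻¹) fun f g => ?_, hB⟩
  refine le_of_sq_le_sq ?_ (by positivity)
  rw [mul_pow, mul_pow, Real.sq_sqrt (inv_pos.2 hδ).le, Ell2.norm_sq, Ell2.norm_sq g,
    ← tsum_mul_left]
  exact (B f g).mem.tsum_le_tsum (fun x => hle f g x) (Summable.mul_left _ g.mem)

variable (G) in
/-- The gradient form as a bilinear form on the Hilbert space of pairs. -/
noncomputable def pairGamma (U W : lp (fun _ : V ⊕ V × V => ℝ) 2) (x : V) : ℝ :=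
  (G.m x)⁻¹ * ∑' y, U (Sum.inr (x, y)) * W (Sum.inr (x, y))

theorem inr_pair_injective (x : V) :
    Function.Injective fun y : V => (Sum.inr (x, y) : V ⊕ V × V) :=
  fun y z h => by simpa using h

theorem summable_inr_mul (U W : lp (fun _ : V ⊕ V × V => ℝ) 2) (x : V) :
    Summable fun y => U (Sum.inr (x, y)) * W (Sum.inr (x, y)) := by
  have h : Summable fun i => U i * W i :=
    (lp.summable_inner W U).congr fun i => by simp
  exact h.comp_injective (inr_pair_injective x)

theorem summable_inr_sq (W : lp (fun _ : V ⊕ V × V => ℝ) 2) :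
    Summable fun p : V × V => W (Sum.inr p) ^ 2 :=
  (summable_sq_lp W).comp_injective Sum.inr_injective

theorem pairGamma_add_left (U U' W : lp (fun _ : V ⊕ V × V => ℝ) 2) (x : V) :
    G.pairGamma (U + U') W x = G.pairGamma U W x + G.pairGamma U' W x := by
  rw [pairGamma, pairGamma, pairGamma, ← mul_add,
    ← (summable_inr_mul U W x).tsum_add (summable_inr_mul U' W x)]
  simp only [lp.coeFn_add, Pi.add_apply, add_mul]

theorem pairGamma_smul_left (c : ℝ) (U W : lp (fun _ : V ⊕ V × V => ℝ) 2) (x : V) :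
    G.pairGamma (c • U) W x = c * G.pairGamma U W x := by
  rw [pairGamma, pairGamma, mul_left_comm, ← tsum_mul_left (a := c)]
  simp only [lp.coeFn_smul, Pi.smul_apply, smul_eq_mul, mul_assoc]

theorem pairGamma_comm (U W : lp (fun _ : V ⊕ V × V => ℝ) 2) :
    G.pairGamma U W = G.pairGamma W U := by
  funext x
  simp only [pairGamma, mul_comm (U _)]

/-- Cauchy–Schwarz on the row of x. The row of U is bounded by all of ‖U‖, while that of W is kept,
so that summing over x costs only ‖W‖². -/
theorem sq_tsum_inr_mul_le (U W : lp (fun _ : V ⊕ V × V => ℝ) 2) (x : V) :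
    (∑' y, U (Sum.inr (x, y)) * W (Sum.inr (x, y))) ^ 2 ≤
      ‖U‖ ^ 2 * ∑' y, W (Sum.inr (x, y)) ^ 2 := by
  let slice : lp (fun _ : V ⊕ V × V => ℝ) 2 → lp (fun _ : V => ℝ) 2 := fun U =>
    ⟨fun y => U (Sum.inr (x, y)),
      memℓp_two_iff.2 ((summable_sq_lp U).comp_injective (inr_pair_injective x))⟩
  have h1 : inner ℝ (slice W) (slice U) =
      ∑' y, U (Sum.inr (x, y)) * W (Sum.inr (x, y)) := by
    rw [lp.inner_eq_tsum]
    rfl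
  have h2 : ‖slice W‖ ^ 2 = ∑' y, W (Sum.inr (x, y)) ^ 2 := norm_sq_lp _
  have h3 : ‖slice U‖ ^ 2 ≤ ‖U‖ ^ 2 := by
    rw [norm_sq_lp, norm_sq_lp]
    exact tsum_comp_le_tsum_of_inj (summable_sq_lp U) (fun _ => sq_nonneg _)
      (inr_pair_injective x)
  rw [← h1, ← h2, ← sq_abs]
  have h4 := pow_le_pow_left₀ (abs_nonneg _) (abs_real_inner_le_norm (slice W) (slice U)) 2
  rw [mul_pow, mul_comm] at h4
  exact h4.trans (mul_le_mul_of_nonneg_right h3 (sq_nonneg _))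

theorem m_mul_pairGamma_sq_le {δ : ℝ} (hδ : 0 < δ) (hδm : ∀ x, δ ≤ G.m x)
    (U W : lp (fun _ : V ⊕ V × V => ℝ) 2) (x : V) :
    G.m x * G.pairGamma U W x ^ 2 ≤ δ⁻¹ * ‖U‖ ^ 2 * ∑' y, W (Sum.inr (x, y)) ^ 2 := by
  have e : G.m x * G.pairGamma U W x ^ 2 =
      (G.m x)⁻¹ * (∑' y, U (Sum.inr (x, y)) * W (Sum.inr (x, y))) ^ 2 := by
    have := (G.m_pos x).ne'
    rw [pairGamma]
    field_simp
  rw [e, mul_assoc]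
  exact mul_le_mul (inv_anti₀ hδ (hδm x)) (sq_tsum_inr_mul_le U W x) (sq_nonneg _)
    (inv_pos.2 hδ).le

theorem memEll2_pairGamma {δ : ℝ} (hδ : 0 < δ) (hδm : ∀ x, δ ≤ G.m x)
    (U W : lp (fun _ : V ⊕ V × V => ℝ) 2) : G.MemEll2 (G.pairGamma U W) :=
  Summable.of_nonneg_of_le (fun x => mul_nonneg (G.m_pos x).le (sq_nonneg _))
    (m_mul_pairGamma_sq_le hδ hδm U W) (Summable.mul_left _ (summable_inr_sq W).prod)

/-- On a graph with nondegenerate measure, the gradient form extends to a bounded bilinear map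
from the Hilbert space of pairs into `ℓ²(V, m)`. -/
theorem Nondegenerate.exists_gamma (hm : G.Nondegenerate) :
    ∃ Γ : lp (fun _ : V ⊕ V × V => ℝ) 2 →L[ℝ] lp (fun _ : V ⊕ V × V => ℝ) 2 →L[ℝ] G.Ell2,
      ∀ U W x, Γ U W x = G.pairGamma U W x := by
  obtain ⟨δ, hδ, hδm⟩ := hm
  let B : lp (fun _ : V ⊕ V × V => ℝ) 2 →ₗ[ℝ] lp (fun _ : V ⊕ V × V => ℝ) 2 →ₗ[ℝ] G.Ell2 :=
    LinearMap.mk₂ ℝ (fun U W => (⟨_, memEll2_pairGamma hδ hδm U W⟩ : G.ell2Submodule))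
      (fun U U' W => Ell2.ext fun x => pairGamma_add_left U U' W x)
      (fun c U W => Ell2.ext fun x => pairGamma_smul_left c U W x)
      (fun U W W' => Ell2.ext fun x => by
        change G.pairGamma U (W + W') x = G.pairGamma U W x + G.pairGamma U W' x
        rw [pairGamma_comm, pairGamma_add_left, pairGamma_comm W, pairGamma_comm W'])
      (fun c U W => Ell2.ext fun x => by
        change G.pairGamma U (c • W) x = c * G.pairGamma U W x
        rw [pairGamma_comm, pairGamma_smul_left, pairGamma_comm W])
  have hB : ∀ U W x, B U W x = G.pairGamma U W x := fun U W x => rfl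
  refine ⟨B.mkContinuous₂ √(δ⁻¹) fun U W => ?_, hB⟩
  refine le_of_sq_le_sq ?_ (by positivity)
  rw [mul_pow, mul_pow, Real.sq_sqrt (inv_pos.2 hδ).le, Ell2.norm_sq]
  refine ((B U W).mem.tsum_le_tsum (fun x => m_mul_pairGamma_sq_le hδ hδm U W x)
    (Summable.mul_left _ (summable_inr_sq W).prod)).trans ?_
  rw [tsum_mul_left]
  refine mul_le_mul_of_nonneg_left ?_ (mul_nonneg (inv_pos.2 hδ).le (sq_nonneg _))
  rw [← (summable_inr_sq W).tsum_prod, norm_sq_lp]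
  exact tsum_comp_le_tsum_of_inj (summable_sq_lp W) (fun _ => sq_nonneg _) Sum.inr_injective

theorem pairGamma_eq {U W : lp (fun _ : V ⊕ V × V => ℝ) 2} {f g : V → ℝ}
    (hU : (U : V ⊕ V × V → ℝ) = G.embed f) (hW : (W : V ⊕ V × V → ℝ) = G.embed g) (x : V) :
    G.pairGamma U W x = G.gamma f g x := by
  rw [pairGamma, hU, hW, (G.hasSum_embed_inr_mul f g x).tsum_eq,
    inv_mul_cancel_left₀ (G.m_pos x).ne']

theorem proj_eq {w : lp (fun _ : V ⊕ V × V => ℝ) 2} {f : V → ℝ}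
    (hw : (w : V ⊕ V × V → ℝ) = G.embed f) : (G.proj w : V → ℝ) = f := by
  funext x
  rw [proj_apply, hw]
  exact mul_div_cancel_left₀ _ (Real.sqrt_pos.2 (G.m_pos x)).ne'

variable (G) in
/-- The resolvent, with values in the Hilbert space of pairs. -/
noncomputable def lift : G.Ell2 →L[ℝ] lp (fun _ : V ⊕ V × V => ℝ) 2 :=
  G.formSpace.subtypeL.comp (ContinuousLinearMap.adjoint G.incl)

/-- Since (1 - Δ)⁻¹ maps f - h to f, the gradient of f is a bounded linear image of f - h.
Continuity and derivatives of an orbit in ℓ² thus transfer to the form norm. -/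
theorem LapTo.coe_lift {f h : G.Ell2} (hf : G.LapTo f h) :
    (G.lift (f - h) : V ⊕ V × V → ℝ) = G.embed f := by
  have h1 := G.embed_proj (ContinuousLinearMap.adjoint G.incl (f - h)).2
  have h2 : G.proj (ContinuousLinearMap.adjoint G.incl (f - h)) = f := hf.resolvent_sub
  rw [h2] at h1
  exact h1

theorem heat_coe (t : ℝ) (f : G.Ell2) : G.heat t f = (G.heatSemigroup t f : V → ℝ) :=
  dif_pos f.mem

open Classical in
-- The mass is divided by m x so that pairing is evaluation at x. This turns statements tested
-- against nonnegative h into pointwise ones, and shows evaluation to be continuous.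
theorem exists_pointMass (G : WeightedGraph V) (x : V) :
    ∃ h h' : G.Ell2, G.LapTo h h' ∧ (∀ y, 0 ≤ h y) ∧ ∀ g : G.Ell2, inner ℝ h g = g x := by
  have hfin : (Function.support (Pi.single x (G.m x)⁻¹ : V → ℝ)).Finite :=
    (Set.finite_singleton x).subset fun y hy => by
      by_contra h
      exact hy (Pi.single_eq_of_ne h _)
  refine ⟨_, _, G.lapTo_ofFinite hfin, fun y => ?_, fun g => ?_⟩
  · change 0 ≤ (Pi.single x (G.m x)⁻¹ : V → ℝ) y
    rcases eq_or_ne y x with rfl | hy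
    · rw [Pi.single_eq_same]
      exact (inv_pos.2 (G.m_pos y)).le
    · rw [Pi.single_eq_of_ne hy]
  · rw [Ell2.inner_def, tsum_eq_single x]
    · change G.m x * ((Pi.single x (G.m x)⁻¹ : V → ℝ) x * g x) = g x
      rw [Pi.single_eq_same, mul_inv_cancel_left₀ (G.m_pos x).ne']
    · intro y hy
      change G.m y * ((Pi.single x (G.m x)⁻¹ : V → ℝ) y * g y) = 0
      rw [Pi.single_eq_of_ne hy]; ring

theorem continuous_eval (x : V) : Continuous fun f : G.Ell2 => f x := by
  obtain ⟨h, -, -, -, hx⟩ := G.exists_pointMass x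
  simp only [← hx]
  fun_prop

/-! ### Derivatives of the interpolating pairings. -/

section pairing

variable {E : Type*} [NormedAddCommGroup E] [NormedSpace ℝ E]

theorem hasDerivAt_quadratic {F : Type*} [NormedAddCommGroup F] [NormedSpace ℝ F]
    {B : E →L[ℝ] E →L[ℝ] F} (hB : ∀ u v, B u v = B v u)
    {u : ℝ → E} {u' : E} {s : ℝ} (hu : HasDerivAt u u' s) :
    HasDerivAt (fun s => B (u s) (u s)) ((2 : ℝ) • B (u s) u') s := by
  have h1 : HasDerivAt (fun s => B (u s)) (B u') s :=
    (B.hasFDerivAt (x := u s)).comp_hasDerivAt s hu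
  refine (h1.clm_apply hu).congr_deriv ?_
  rw [hB u', two_smul]

/-- Covers both interpolating functions: L is the identity and B the product for φ, while L is
`lift` and B the gradient form for ψ. The minus sign comes from the reversed time t - s. -/
theorem LapTo.hasDerivAt_pairing (L : G.Ell2 →L[ℝ] E) {B : E →L[ℝ] E →L[ℝ] G.Ell2}
    (hB : ∀ u v, B u v = B v u) {a a' h h' : G.Ell2} (ha : G.LapTo a a') (hh : G.LapTo h h')
    {s t : ℝ} (hs : 0 < s) (hst : s < t) :
    HasDerivAt (fun s => inner ℝ (G.heatSemigroup s h)
      (B (L (G.heatSemigroup (t - s) a)) (L (G.heatSemigroup (t - s) a))))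
      (inner ℝ (G.heatSemigroup s h')
        (B (L (G.heatSemigroup (t - s) a)) (L (G.heatSemigroup (t - s) a))) -
      2 * inner ℝ (G.heatSemigroup s h)
        (B (L (G.heatSemigroup (t - s) a)) (L (G.heatSemigroup (t - s) a')))) s := by
  have h1 : HasDerivAt (fun s => G.heatSemigroup (t - s) a) (-G.heatSemigroup (t - s) a') s := by
    have := (ha.hasDerivAt (sub_pos.2 hst)).scomp s ((hasDerivAt_id s).const_sub t)
    rw [neg_one_smul] at this
    exact this
  have h2 : HasDerivAt (fun s => L (G.heatSemigroup (t - s) a))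
      (-L (G.heatSemigroup (t - s) a')) s := by
    rw [← map_neg]
    exact L.hasFDerivAt.comp_hasDerivAt s h1
  refine ((hh.hasDerivAt hs).inner ℝ (hasDerivAt_quadratic hB h2)).congr_deriv ?_
  rw [map_neg, smul_neg, inner_neg_right, real_inner_smul_right]
  ring

theorem continuousOn_pairing (L : G.Ell2 →L[ℝ] E) (B : E →L[ℝ] E →L[ℝ] G.Ell2)
    (a h : G.Ell2) (t : ℝ) :
    ContinuousOn (fun s => inner ℝ (G.heatSemigroup s h)
      (B (L (G.heatSemigroup (t - s) a)) (L (G.heatSemigroup (t - s) a)))) (Set.Icc 0 t) := by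
  have hP := G.isC0Semigroup_heatSemigroup
  have h1 : ContinuousOn (fun s => G.heatSemigroup (t - s) a) (Set.Icc 0 t) :=
    (hP.continuousOn a).comp (by fun_prop) fun s hs => Set.mem_Ici.2 (sub_nonneg.2 hs.2)
  have h2 : Continuous fun u : G.Ell2 => B (L u) (L u) := by fun_prop
  exact ((hP.continuousOn h).mono Set.Icc_subset_Ici_self).inner (h2.comp_continuousOn h1)

end pairing

end WeightedGraph

/-! ### The Poincaré constant and the Grönwall argument. -/

/-- The derivative has one formula for all K. Together with the value 0 at time zero, it is all that
the Grönwall argument uses of the constant. -/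
theorem hasDerivAt_poincareConst (K t : ℝ) :
    HasDerivAt (poincareConst K) (2 * Real.exp (-2 * K * t)) t := by
  by_cases hK : K = 0
  · have e : poincareConst K = fun t => 2 * t := by
      funext t
      rw [poincareConst, if_pos hK]
    rw [e, hK]
    simpa using (hasDerivAt_id t).const_mul 2
  · have e : poincareConst K = fun t => (1 - Real.exp (-2 * K * t)) / K := by
      funext t
      rw [poincareConst, if_neg hK]
    rw [e]
    have h := ((((hasDerivAt_id t).const_mul (-2 * K)).exp).const_sub 1).div_const K
    refine h.congr_deriv ?_
    simp only [id]
    field_simp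

theorem poincareConst_zero (K : ℝ) : poincareConst K 0 = 0 := by
  unfold poincareConst
  split_ifs <;> simp

/-- A Grönwall argument: if `φ' ≤ 2ψ` and `ψ' ≥ 2Kψ`, then the increment of `φ` is controlled by
the final value of `ψ`. -/
theorem sub_le_poincareConst_mul {φ ψ φ' ψ' : ℝ → ℝ} {K t : ℝ} (ht : 0 ≤ t)
    (hφ : ContinuousOn φ (Set.Icc 0 t)) (hψ : ContinuousOn ψ (Set.Icc 0 t))
    (hφ' : ∀ s ∈ Set.Ioo 0 t, HasDerivAt φ (φ' s) s)
    (hψ' : ∀ s ∈ Set.Ioo 0 t, HasDerivAt ψ (ψ' s) s)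
    (h1 : ∀ s ∈ Set.Ioo 0 t, φ' s ≤ 2 * ψ s)
    (h2 : ∀ s ∈ Set.Ioo 0 t, 2 * K * ψ s ≤ ψ' s) :
    φ t - φ 0 ≤ poincareConst K t * ψ t := by
  have he : ∀ s, HasDerivAt (fun s => Real.exp (-2 * K * s))
      (Real.exp (-2 * K * s) * (-2 * K)) s := fun s => by
    simpa using ((hasDerivAt_id s).const_mul (-2 * K)).exp
  -- The integrating factor turns ψ' ≥ 2Kψ into ψ(s) ≤ e^{-2K(t-s)} ψ(t).
  have hmono : MonotoneOn (fun s => Real.exp (-2 * K * s) * ψ s) (Set.Icc 0 t) := by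
    have hd : ∀ s ∈ Set.Ioo 0 t, HasDerivAt (fun s => Real.exp (-2 * K * s) * ψ s)
        (Real.exp (-2 * K * s) * (-2 * K) * ψ s + Real.exp (-2 * K * s) * ψ' s) s :=
      fun s hs => (he s).mul (hψ' s hs)
    refine monotoneOn_of_deriv_nonneg (convex_Icc 0 t)
      ((by fun_prop : Continuous fun s => Real.exp (-2 * K * s)).continuousOn.mul hψ)
      (fun s hs => (hd s (by rwa [interior_Icc] at hs)).differentiableAt.differentiableWithinAt)
      (fun s hs => ?_)
    rw [interior_Icc] at hs
    rw [(hd s hs).deriv]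
    nlinarith [mul_le_mul_of_nonneg_left (h2 s hs) (Real.exp_pos (-2 * K * s)).le]
  have hc : ∀ s, HasDerivAt (fun s => poincareConst K (t - s))
      (-(2 * Real.exp (-2 * K * (t - s)))) s := fun s => by
    simpa [Function.comp_def] using
      (hasDerivAt_poincareConst K (t - s)).scomp s ((hasDerivAt_id s).const_sub t)
  -- The constant is run backwards in time: its derivative -2e^{-2K(t-s)}, multiplied by ψ(t),
  -- compensates the bound φ' ≤ 2ψ(s) ≤ 2e^{-2K(t-s)} ψ(t).
  have hanti : AntitoneOn (fun s => φ s + poincareConst K (t - s) * ψ t) (Set.Icc 0 t) := by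
    have hd : ∀ s ∈ Set.Ioo 0 t, HasDerivAt (fun s => φ s + poincareConst K (t - s) * ψ t)
        (φ' s + -(2 * Real.exp (-2 * K * (t - s))) * ψ t) s :=
      fun s hs => (hφ' s hs).add ((hc s).mul_const _)
    refine antitoneOn_of_deriv_nonpos (convex_Icc 0 t)
      (hφ.add fun s _ => ((hc s).continuousAt.mul continuousAt_const).continuousWithinAt)
      (fun s hs => (hd s (by rwa [interior_Icc] at hs)).differentiableAt.differentiableWithinAt)
      (fun s hs => ?_)
    rw [interior_Icc] at hs
    rw [(hd s hs).deriv]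
    have h3 : Real.exp (-2 * K * s) * ψ s ≤ Real.exp (-2 * K * t) * ψ t :=
      hmono ⟨hs.1.le, hs.2.le⟩ ⟨ht, le_rfl⟩ hs.2.le
    have h4 : Real.exp (-2 * K * t) = Real.exp (-2 * K * (t - s)) * Real.exp (-2 * K * s) := by
      rw [← Real.exp_add]; congr 1; ring
    have h5 : ψ s ≤ Real.exp (-2 * K * (t - s)) * ψ t := by
      refine le_of_mul_le_mul_left ?_ (Real.exp_pos (-2 * K * s))
      rw [h4] at h3
      linarith
    linarith [h1 s hs]
  have := hanti (a := 0) (b := t) ⟨le_rfl, ht⟩ ⟨ht, le_rfl⟩ ht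
  simp only [sub_self, sub_zero, poincareConst_zero, zero_mul, add_zero] at this
  linarith

/-! ### From the curvature condition to the Poincaré inequality, and its extension to D(Q). -/

namespace WeightedGraph

variable {V : Type u} {G : WeightedGraph V}

/-- The local Poincaré inequality, tested against a nonnegative function in the domain of the
Laplacian. -/
theorem CD.inner_heat_sub_le {K : ℝ} (hCD : G.CD K) (hG : G.IsComplete)
    {M : G.Ell2 →L[ℝ] G.Ell2 →L[ℝ] G.Ell2} (hM : ∀ f g x, M f g x = f x * g x)
    {Γ : lp (fun _ : V ⊕ V × V => ℝ) 2 →L[ℝ] lp (fun _ : V ⊕ V × V => ℝ) 2 →L[ℝ] G.Ell2}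
    (hΓ : ∀ U W x, Γ U W x = G.pairGamma U W x) {a a' a'' : G.Ell2} (ha : G.LapTo a a')
    (ha' : G.LapTo a' a'') {h h' : G.Ell2} (hh : G.LapTo h h') (h0 : ∀ x, 0 ≤ h x) {t : ℝ}
    (ht : 0 ≤ t) :
    inner ℝ (G.heatSemigroup t h) (M a a) -
        inner ℝ h (M (G.heatSemigroup t a) (G.heatSemigroup t a)) ≤
      poincareConst K t * inner ℝ (G.heatSemigroup t h) (Γ (G.lift (a - a')) (G.lift (a - a'))) := by
  have hP := G.isC0Semigroup_heatSemigroup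
  have hMs : ∀ f g, M f g = M g f := fun f g => Ell2.ext fun x => by rw [hM, hM, mul_comm]
  have hΓs : ∀ U W, Γ U W = Γ W U := fun U W => Ell2.ext fun x => by
    rw [hΓ, hΓ, pairGamma_comm]
  have hlift : ∀ {r : ℝ}, 0 ≤ r →
      (G.lift (G.heatSemigroup r (a - a')) : V ⊕ V × V → ℝ) =
        G.embed (G.heatSemigroup r a) := fun hr => by
    rw [map_sub]
    exact (ha.heat hr).coe_lift
  have hlift' : ∀ {r : ℝ}, 0 ≤ r →
      (G.lift (G.heatSemigroup r (a' - a'')) : V ⊕ V × V → ℝ) =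
        G.embed (G.heatSemigroup r a') := fun hr => by
    rw [map_sub]
    exact (ha'.heat hr).coe_lift
  -- For ψ the orbit that is lifted starts at a - Δa, whose differentiability requires a' = Δa to be
  -- in the domain as well; this is the role of a''.
  have key := sub_le_poincareConst_mul (K := K) ht
    (continuousOn_pairing (ContinuousLinearMap.id ℝ G.Ell2) M a h t)
    (continuousOn_pairing G.lift Γ (a - a') h t)
    (fun s hs => ha.hasDerivAt_pairing (ContinuousLinearMap.id ℝ G.Ell2) hMs hh hs.1 hs.2)
    (fun s hs => (ha.sub ha').hasDerivAt_pairing G.lift hΓs hh hs.1 hs.2) ?_ ?_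
  · simpa [hP.zero_apply] using key
  · intro s hs
    have hr : 0 ≤ t - s := (sub_pos.2 hs.2).le
    simp only [ContinuousLinearMap.id_apply]
    set u := G.heatSemigroup (t - s) a with hu
    set u' := G.heatSemigroup (t - s) a' with hu'
    set U := G.lift (G.heatSemigroup (t - s) (a - a')) with hU
    -- The bound φ' ≤ 2ψ uses g = -u², for which F = Δg exactly, so both subsolution conditions hold
    -- with equality.
    have hlap : ∀ x, (-((2 : ℝ) • M u u' + (2 : ℝ) • Γ U U) : G.Ell2) x =
        G.laplacian (-(M u u) : G.Ell2) x := by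
      intro x
      have e1 : ((-(M u u) : G.Ell2) : V → ℝ) = -((u : V → ℝ) * (u : V → ℝ)) := by
        funext y
        change -(M u u y) = _
        rw [hM]; rfl
      rw [e1, laplacian_neg, laplacian_mul, (ha.heat hr).2]
      change -(2 * M u u' x + 2 * Γ U U x) = _
      rw [hM, hΓ, pairGamma_eq (hlift hr) (hlift hr)]
      ring
    have := (hh.heat hs.1.le).inner_le_of_subsolution hG
      (fun x => hh.heat_nonneg hG h0 hs.1.le x) (fun x => (hlap x).le)
      (fun x => by rw [hlap x])
    rw [inner_neg_right, inner_neg_right, inner_add_right, real_inner_smul_right,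
      real_inner_smul_right] at this
    linarith
  · intro s hs
    have hr : 0 ≤ t - s := (sub_pos.2 hs.2).le
    set u := G.heatSemigroup (t - s) a with hu
    set u' := G.heatSemigroup (t - s) a' with hu'
    set U := G.lift (G.heatSemigroup (t - s) (a - a')) with hU
    set U' := G.lift (G.heatSemigroup (t - s) (a' - a'')) with hU'
    have e1 : ((Γ U U : G.Ell2) : V → ℝ) = G.gamma u u := by
      funext y
      rw [hΓ, pairGamma_eq (hlift hr) (hlift hr)]
    -- The curvature condition for u in the form ΔΓ(u) ≥ 2Γ(u, Δu) + 2KΓ(u): here g = Γ(u) is a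
    -- subsolution, and g ≥ 0 gives the condition multiplied by g.
    have hlap : ∀ x, ((2 : ℝ) • Γ U U' + (2 * K) • Γ U U : G.Ell2) x ≤
        G.laplacian (Γ U U) x := by
      intro x
      have h1 := hCD u x
      have h2 : G.laplacian u = u' := funext (ha.heat hr).2
      rw [gamma₂, h2] at h1
      rw [e1]
      change 2 * Γ U U' x + 2 * K * Γ U U x ≤ _
      rw [hΓ, hΓ, pairGamma_eq (hlift hr) (hlift hr), pairGamma_eq (hlift hr) (hlift' hr)]
      linarith
    have := (hh.heat hs.1.le).inner_le_of_subsolution hG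
      (fun x => hh.heat_nonneg hG h0 hs.1.le x) hlap
      (fun x => by
        refine mul_le_mul_of_nonneg_left (hlap x) ?_
        rw [e1]
        exact G.gamma_self_nonneg _ _)
    rw [inner_add_right, real_inner_smul_right, real_inner_smul_right] at this
    linarith

theorem MemDQ.memEll2 {f : V → ℝ} (hf : G.MemDQ f) : G.MemEll2 f := by
  obtain ⟨w, -, hwf⟩ := G.exists_of_memDQ hf
  rw [← proj_eq hwf]
  exact Ell2.mem _

/-- `CD(K, ∞)` implies the local Poincaré inequality for finitely supported functions. -/
theorem CD.heat_sq_sub_le {K : ℝ} (hCD : G.CD K) (hG : G.IsComplete) (hm : G.Nondegenerate)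
    {f : V → ℝ} (hf : (Function.support f).Finite) {t : ℝ} (ht : 0 ≤ t) (x : V) :
    G.heat t (f ^ 2) x - (G.heat t f x) ^ 2 ≤
      poincareConst K t * G.heat t (G.gamma f f) x := by
  obtain ⟨M, hM⟩ := hm.exists_mul
  obtain ⟨Γ, hΓ⟩ := hm.exists_gamma
  obtain ⟨h, h', hh, h0, hx⟩ := G.exists_pointMass x
  have ha := G.lapTo_ofFinite hf
  have ha' := G.lapTo_ofFinite (G.finite_support_laplacian hf)
  have key := hCD.inner_heat_sub_le hG hM hΓ ha ha' hh h0 ht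
  have hf2 : (Function.support (f ^ 2)).Finite := hf.subset fun y hy hy0 => hy (by simp [hy0])
  have hΓf := G.finite_support_gamma hf f
  have e1 : M (G.ofFinite f hf) (G.ofFinite f hf) = G.ofFinite _ hf2 := Ell2.ext fun y => by
    rw [hM]
    exact (sq (f y)).symm
  have e2 : Γ (G.lift (G.ofFinite f hf - G.ofFinite _ (G.finite_support_laplacian hf)))
      (G.lift (G.ofFinite f hf - G.ofFinite _ (G.finite_support_laplacian hf))) =
      G.ofFinite _ hΓf := Ell2.ext fun y => by
    rw [hΓ, pairGamma_eq ha.coe_lift ha.coe_lift]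
    rfl
  rw [e2, e1, hh.inner_heat_comm (G.lapTo_ofFinite hf2) ht,
    hh.inner_heat_comm (G.lapTo_ofFinite hΓf) ht, hx, hx, hx, hM, ← sq, ← heat_coe, ← heat_coe,
    ← heat_coe] at key
  exact key

/-- The local Poincaré inequality extends from the finitely supported functions to `D(Q)`. -/
theorem heat_sq_sub_le_of_finite {K t : ℝ} {x : V} (hm : G.Nondegenerate)
    (h : ∀ f : V → ℝ, (Function.support f).Finite →
      G.heat t (f ^ 2) x - (G.heat t f x) ^ 2 ≤ poincareConst K t * G.heat t (G.gamma f f) x)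
    {f : V → ℝ} (hf : G.MemDQ f) :
    G.heat t (f ^ 2) x - (G.heat t f x) ^ 2 ≤ poincareConst K t * G.heat t (G.gamma f f) x := by
  obtain ⟨M, hM⟩ := hm.exists_mul
  obtain ⟨Γ, hΓ⟩ := hm.exists_gamma
  have hiff : ∀ {w : lp (fun _ : V ⊕ V × V => ℝ) 2} {f : V → ℝ},
      (w : V ⊕ V × V → ℝ) = G.embed f →
      ((G.heatSemigroup t (M (G.proj w) (G.proj w))) x - (G.heatSemigroup t (G.proj w) x) ^ 2 ≤
        poincareConst K t * G.heatSemigroup t (Γ w w) x ↔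
      G.heat t (f ^ 2) x - (G.heat t f x) ^ 2 ≤
        poincareConst K t * G.heat t (G.gamma f f) x) := by
    intro w f hw
    have e0 := proj_eq hw
    have e1 : ((M (G.proj w) (G.proj w) : G.Ell2) : V → ℝ) = f ^ 2 := by
      funext y
      rw [hM, e0, Pi.pow_apply, sq]
    have e2 : ((Γ w w : G.Ell2) : V → ℝ) = G.gamma f f := by
      funext y
      rw [hΓ, pairGamma_eq hw hw]
    rw [← heat_coe, ← heat_coe, ← heat_coe, e1, e2, e0]
  obtain ⟨w, hw, hwf⟩ := G.exists_of_memDQ hf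
  rw [← hiff hwf]
  have hev := continuous_eval (G := G) x
  -- All three terms are continuous in w, as P_t, the product, Γ and evaluation at x are bounded;
  -- the form space is the closure of `core`, where the inequality is assumed.
  have hclosed : IsClosed {w : lp (fun _ : V ⊕ V × V => ℝ) 2 |
      (G.heatSemigroup t (M (G.proj w) (G.proj w))) x - (G.heatSemigroup t (G.proj w) x) ^ 2 ≤
        poincareConst K t * G.heatSemigroup t (Γ w w) x} := by
    refine isClosed_le ?_ ?_
    · refine (hev.comp (by fun_prop : Continuous fun w => G.heatSemigroup t
        (M (G.proj w) (G.proj w)))).sub (Continuous.pow (hev.comp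
          (by fun_prop : Continuous fun w => G.heatSemigroup t (G.proj w))) 2)
    · exact continuous_const.mul (hev.comp
        (by fun_prop : Continuous fun w => G.heatSemigroup t (Γ w w)))
  refine closure_minimal (s := (G.core : Set (lp (fun _ : V ⊕ V × V => ℝ) 2))) ?_ hclosed hw
  rintro v ⟨g, hg, hv⟩
  exact (hiff hv).2 (h g hg)

end WeightedGraph

/-! ### Expansion at time zero and the converse implication. -/

theorem tendsto_poincareConst_second_order (K : ℝ) :
    Tendsto (fun t => (poincareConst K t - 2 * t) / t ^ 2) (𝓝[>] 0) (𝓝 (-2 * K)) := by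
  by_cases hK : K = 0
  · subst hK
    simp [poincareConst]
  -- For z = -2Kt, the cubic Taylor remainder of exp is at most |z|³ · 4/(3!·3) = (2/9)|z|³;
  -- dividing by |K| t² leaves this expression.
  have hlim : Tendsto (fun t : ℝ => |-2 * K * t| * (2 / 9) * (4 * |K|)) (𝓝[>] 0) (𝓝 0) := by
    have : Continuous fun t : ℝ => |-2 * K * t| * (2 / 9) * (4 * |K|) := by fun_prop
    simpa using (this.tendsto 0).mono_left nhdsWithin_le_nhds
  have hsmall : ∀ᶠ t : ℝ in 𝓝[>] 0, |-2 * K * t| ≤ 1 := by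
    have : Continuous fun t : ℝ => |-2 * K * t| := by fun_prop
    have h0 : ∀ᶠ t in 𝓝 (0 : ℝ), |-2 * K * t| < 1 :=
      this.continuousAt.eventually_lt continuousAt_const (by simp)
    exact (h0.filter_mono nhdsWithin_le_nhds).mono fun t ht => ht.le
  rw [tendsto_iff_norm_sub_tendsto_zero]
  refine squeeze_zero' (Eventually.of_forall fun _ => norm_nonneg _) ?_ hlim
  filter_upwards [hsmall, self_mem_nhdsWithin] with t ht ht0
  have ht0' : t ≠ 0 := (Set.mem_Ioi.1 ht0).ne'
  have hb := Real.exp_bound ht (n := 3) (by norm_num)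
  have e : (poincareConst K t - 2 * t) / t ^ 2 - -2 * K =
      -(Real.exp (-2 * K * t) - ∑ m ∈ Finset.range 3, (-2 * K * t) ^ m / (m.factorial : ℝ)) /
        (K * t ^ 2) := by
    rw [poincareConst, if_neg hK]
    simp [Finset.sum_range_succ, Nat.factorial]
    field_simp
    ring
  rw [e, Real.norm_eq_abs, abs_div, abs_neg, div_le_iff₀ (by positivity)]
  refine hb.trans (le_of_eq ?_)
  have e2 : |-2 * K * t| = 2 * |K| * |t| := by simp [abs_mul]
  rw [e2, abs_mul, abs_pow]
  norm_num [Nat.factorial]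
  rw [← sq_abs t]
  ring

namespace WeightedGraph

variable {V : Type u} {G : WeightedGraph V}

theorem tendsto_heat_second_order {f h k : G.Ell2} (hf : G.LapTo f h) (hh : G.LapTo h k) (x : V) :
    Tendsto (fun t : ℝ => (G.heatSemigroup t f x - f x - t * h x) / t ^ 2) (𝓝[>] 0)
      (𝓝 (1 / 2 * k x)) := by
  have h1 := G.isC0Semigroup_heatSemigroup.tendsto_second_order
    (G.generatorMapsTo_iff.2 hf) (G.generatorMapsTo_iff.2 hh)
  refine (((continuous_eval x).tendsto _).comp h1).congr fun t => ?_
  rw [div_eq_inv_mul]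
  rfl

/-- The second-order expansion at time zero of the local Poincaré inequality for a finitely
supported function. -/
theorem mul_gamma_le_of_heat {K : ℝ} {f : V → ℝ} (hf : (Function.support f).Finite) {x : V}
    (h : ∀ t : ℝ, 0 ≤ t → G.heat t (f ^ 2) x - (G.heat t f x) ^ 2 ≤
      poincareConst K t * G.heat t (G.gamma f f) x) :
    K * G.gamma f f x ≤ G.gamma₂ f f x := by
  have hL := G.finite_support_laplacian hf
  have hLL := G.finite_support_laplacian hL
  have hq : (Function.support (f ^ 2)).Finite := hf.subset fun y hy hy0 => hy (by simp [hy0])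
  have hqL := G.finite_support_laplacian hq
  have hΓ := G.finite_support_gamma hf f
  have hΓL := G.finite_support_laplacian hΓ
  have lf := tendsto_heat_second_order (G.lapTo_ofFinite hf) (G.lapTo_ofFinite hL) x
  have lq := tendsto_heat_second_order (G.lapTo_ofFinite hq) (G.lapTo_ofFinite hqL) x
  have lΓ := tendsto_heat_second_order (G.lapTo_ofFinite hΓ) (G.lapTo_ofFinite hΓL) x
  have lc := tendsto_poincareConst_second_order K
  simp only [← heat_coe] at lf lq lΓ
  change Tendsto (fun t : ℝ => (G.heat t f x - f x - t * G.laplacian f x) / t ^ 2) _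
    (𝓝 (1 / 2 * G.laplacian (G.laplacian f) x)) at lf
  change Tendsto (fun t : ℝ => (G.heat t (f ^ 2) x - f x ^ 2 - t * G.laplacian (f ^ 2) x) / t ^ 2) _
    (𝓝 (1 / 2 * G.laplacian (G.laplacian (f ^ 2)) x)) at lq
  change Tendsto (fun t : ℝ => (G.heat t (G.gamma f f) x - G.gamma f f x -
    t * G.laplacian (G.gamma f f) x) / t ^ 2) _
    (𝓝 (1 / 2 * G.laplacian (G.laplacian (G.gamma f f)) x)) at lΓ
  have e1 : G.laplacian (f ^ 2) = (2 : ℝ) • (f * G.laplacian f) + (2 : ℝ) • G.gamma f f := by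
    funext y
    rw [sq, laplacian_mul]
    simp only [Pi.add_apply, Pi.smul_apply, Pi.mul_apply, smul_eq_mul]
    ring
  have e2 : G.laplacian (G.laplacian (f ^ 2)) x = 2 * (f x * G.laplacian (G.laplacian f) x +
      G.laplacian f x * G.laplacian f x + 2 * G.gamma f (G.laplacian f) x) +
      2 * G.laplacian (G.gamma f f) x := by
    rw [e1, laplacian_add, laplacian_smul, laplacian_smul, laplacian_mul]
  have e3 : G.laplacian (f ^ 2) x = 2 * (f x * G.laplacian f x) + 2 * G.gamma f f x := by
    rw [e1]; rfl
  have lt : Tendsto (fun t : ℝ => t) (𝓝[>] 0) (𝓝 0) := tendsto_id.mono_left nhdsWithin_le_nhds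
  rw [gamma₂]
  rw [e2] at lq
  rw [e3] at lq
  generalize G.laplacian (G.laplacian f) x = f2 at *
  generalize G.laplacian f x = f1 at *
  generalize G.laplacian (G.laplacian (G.gamma f f)) x = Γ2 at *
  generalize G.laplacian (G.gamma f f) x = Γ1 at *
  generalize G.gamma f (G.laplacian f) x = γ at *
  generalize G.gamma f f x = Γ0 at *
  generalize f x = f0 at *
  -- This limit assembles the right side minus the left side, divided by t², from the normalised
  -- remainders of the constant, of P_t Γ(f), of P_t(f²) and of P_t f. The singular 1/t terms cancel
  -- by `e3`, and the limit is Δ(Γ(f)) - 2Γ(f, Δf) - 2KΓ(f) at x.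
  have lim := ((((((lc.mul_const Γ0).add (((lt.mul lc).const_add 2).mul_const Γ1)).add
    (((lt.const_mul 2).add ((lt.pow 2).mul lc)).mul lΓ)).sub lq).add_const (f1 ^ 2)).add
    ((lf.const_mul (2 * f0)))).add ((lt.mul_const (2 * f1)).mul lf) |>.add
    ((lt.pow 2).mul (lf.pow 2))
  have hlim := ge_of_tendsto lim (b := 0) ?_
  · linarith
  · filter_upwards [self_mem_nhdsWithin] with t ht
    have ht0 : 0 < t := ht
    have h1 : 0 ≤ (poincareConst K t * G.heat t (G.gamma f f) x -
        (G.heat t (f ^ 2) x - (G.heat t f x) ^ 2)) / t ^ 2 :=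
      div_nonneg (sub_nonneg.2 (h t ht0.le)) (sq_nonneg _)
    refine h1.trans_eq ?_
    field_simp
    ring

/-- The local Poincaré inequality for finitely supported functions implies `CD(K, ∞)`. -/
theorem cd_of_heat {K : ℝ} (h : ∀ f : V → ℝ, (Function.support f).Finite → ∀ t : ℝ, 0 ≤ t →
      ∀ x : V, G.heat t (f ^ 2) x - (G.heat t f x) ^ 2 ≤
        poincareConst K t * G.heat t (G.gamma f f) x) : G.CD K := by
  classical
  intro f x
  -- The ball of radius two about x, outside which Γ₂(f)(x) does not see f; truncation to it gives a
  -- finitely supported function with the same Γ and Γ₂ at x.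
  let S : Finset V := ({x} ∪ G.nbrs x) ∪ (G.nbrs x).biUnion G.nbrs
  let g : V → ℝ := fun y => if y ∈ S then f y else 0
  have hg : (Function.support g).Finite := S.finite_toSet.subset fun y hy => by
    by_contra hn
    exact hy (if_neg hn)
  have hx : f x = g x := (if_pos (by simp [S])).symm
  have h1 : ∀ y ∈ G.nbrs x, f y = g y := fun y hy => (if_pos (by simp [S, hy])).symm
  have h2 : ∀ y ∈ G.nbrs x, ∀ z ∈ G.nbrs y, f z = g z := fun y hy z hz =>
    (if_pos (Finset.mem_union_right _ (Finset.mem_biUnion.2 ⟨y, hy, hz⟩))).symm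
  have l0 := G.laplacian_congr hx h1
  have l1 : ∀ y ∈ G.nbrs x, G.laplacian f y = G.laplacian g y := fun y hy =>
    G.laplacian_congr (h1 y hy) (h2 y hy)
  have g0 := G.gamma_congr hx hx h1 h1
  have g1 : ∀ y ∈ G.nbrs x, G.gamma f f y = G.gamma g g y := fun y hy =>
    G.gamma_congr (h1 y hy) (h1 y hy) (h2 y hy) (h2 y hy)
  have e : G.gamma₂ f f x = G.gamma₂ g g x := by
    rw [gamma₂, gamma₂, G.laplacian_congr g0 g1, G.gamma_congr hx l0 h1 l1]
  rw [g0, e]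
  exact mul_gamma_le_of_heat hg fun t ht => h g hg t ht x

/-- Since `heat` takes the default value zero outside ℓ²(V, m), this membership ensures that on D(Q)
the inequality concerns the actual semigroup. -/
theorem Nondegenerate.memEll2_sq_gamma (hm : G.Nondegenerate) {f : V → ℝ} (hf : G.MemDQ f) :
    G.MemEll2 (f ^ 2) ∧ G.MemEll2 (G.gamma f f) := by
  obtain ⟨M, hM⟩ := hm.exists_mul
  obtain ⟨Γ, hΓ⟩ := hm.exists_gamma
  obtain ⟨w, -, hwf⟩ := G.exists_of_memDQ hf
  have e1 : ((M (G.proj w) (G.proj w) : G.Ell2) : V → ℝ) = f ^ 2 := by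
    funext y
    rw [hM, proj_eq hwf, Pi.pow_apply, sq]
  have e2 : ((Γ w w : G.Ell2) : V → ℝ) = G.gamma f f := by
    funext y
    rw [hΓ, pairGamma_eq hwf hwf]
  rw [← e1, ← e2]
  exact ⟨Ell2.mem _, Ell2.mem _⟩

end WeightedGraph

theorem theorem3p2 {V : Type*} (G : WeightedGraph V) (hG : G.IsComplete)
    (hm : G.Nondegenerate) (K : ℝ) :
    -- all functions to which `P_t` is applied below lie in `ℓ²(V, m)`
    (∀ f : V → ℝ, G.MemDQ f →
      G.MemEll2 f ∧ G.MemEll2 (f ^ 2) ∧ G.MemEll2 (G.gamma f f)) ∧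
    List.TFAE [
      G.CD K,
      ∀ f : V → ℝ, (Function.support f).Finite → ∀ t : ℝ, 0 ≤ t → ∀ x : V,
        G.heat t (f ^ 2) x - (G.heat t f x) ^ 2 ≤
          poincareConst K t * G.heat t (G.gamma f f) x,
      ∀ f : V → ℝ, G.MemDQ f → ∀ t : ℝ, 0 ≤ t → ∀ x : V,
        G.heat t (f ^ 2) x - (G.heat t f x) ^ 2 ≤
          poincareConst K t * G.heat t (G.gamma f f) x] := by
  refine ⟨fun f hf => ⟨hf.memEll2, hm.memEll2_sq_gamma hf⟩, ?_⟩
  tfae_have 1 → 2 := fun hCD f hf t ht x => hCD.heat_sq_sub_le hG hm hf ht x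
  tfae_have 2 → 3 := fun h f hf t ht x =>
    WeightedGraph.heat_sq_sub_le_of_finite hm (fun g hg => h g hg t ht x) hf
  tfae_have 3 → 2 := fun h f hf t ht x => h f (G.memDQ_of_finite hf) t ht x
  tfae_have 2 → 1 := WeightedGraph.cd_of_heat
  tfae_finish
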